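/- Let $R$ be an integral domain of characteristic $0$ and let $F$ be a one-dimensional commutative formal group law over $R$. Let $\Phi$ be an irreducible reduced (crystallographic) root system with simple roots $\alpha_1,\dots,\alpha_n$, highest root $\theta$, Weyl group $W$ and coroot lattice $Q^\vee$, and let $T^*=\mathrm{Hom}(Q^\vee,\mathbb Z)$ be its weight lattice (the character lattice of the simple simply connected group $G$ with root system $\Phi$). Put $T_a^*=T^*\oplus\mathbb Z\delta$, $\Phi_a=\{\alpha+k\delta:\alpha\in\Phi,\ k\in\mathbb Z\}$ (the real affine roots) and $\alpha_0=-\theta+\delta$. Let $W_a=W\ltimes Q^\vee$ be the affine Weyl group, acting on $T_a^*$ so that $W$ fixes $\delta$ and $\lambda\in Q^\vee$ acts by $t_\lambda(\mu+m\delta)=\mu+(m-\langle\mu,\lambda\rangle)\delta$; it contains the reflections $s_{\alpha+k\delta}=s_\alpha t_{k\alpha^\vee}$, $s_{\alpha+k\delta}(\mu+m\delta)=\mu+m\delta-\langle\mu,\alpha^\vee\rangle(\alpha+k\delta)$. Let $\hat S=R[[x_\mu\mid\mu\in T_a^*]]/\mathcal J_F$ be the formal group algebra of $T_a^*$, where $R[[x_\mu]]$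 is the completion of the polynomial ring $R[x_\mu\mid\mu\in T_a^*]$ at the ideal generated by the $x_\mu$, and $\mathcal J_F$ is the closure of the ideal generated by $x_0$ and all $x_{\mu+\nu}-F(x_\mu,x_\nu)$. Let $\hat{\mathcal Q}=\hat S[\tfrac1{x_\alpha},\alpha\in\Phi_a]$, on which $W_a$ acts through $w(x_\mu)=x_{w(\mu)}$, and let $\hat{\mathcal Q}_{W_a}$ be the twisted group algebra: the free left $\hat{\mathcal Q}$-module with basis $\eta_w$ $(w\in W_a)$ and product $c\,\eta_w\,c'\eta_{w'}=c\,w(c')\,\eta_{ww'}$. Let $\hat{\mathbf D}_{W_a}\subset\hat{\mathcal Q}_{W_a}$ be the subring generated by $\hat S$ and the elements $\hat X_{\alpha_i}=\frac1{x_{\alpha_i}}(1-\eta_{s_{\alpha_i}})$, $i=0,\dots,n$. Put $\hat{\mathcal Q}_{W_a}^*=\mathrm{Hom}_{\hat{\mathcal Q}}(\hat{\mathcal Q}_{W_a},\hat{\mathcal Q})$ and $\hat{\mathbf D}_{W_a}^*=\mathrm{Hom}_{\hat S}(\hat{\mathbf D}_{W_a},\hat S)$ (left modules). If $2$ is not invertible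 in $R$, assume moreover that $x_\alpha$ and $x_\beta$ are coprime in $\hat S$ (that is, $x_\alpha\mid x_\beta g$ implies $x_\alpha\mid g$ for $g\in\hat S$) whenever $\alpha,\beta\in\Phi_a$ are both divisible by $2$ in $T_a^*$ and $\beta\neq\pm\alpha$. (No real affine root is divisible by $2$ unless $G=\mathrm{Sp}_{2n}$ for some $n\ge1$, where $\mathrm{Sp}_2=\mathrm{SL}_2$; so this is no condition for any other $G$.) Then every $\varphi\in\hat{\mathbf D}_{W_a}^*$ has a unique extension to an element of $\hat{\mathcal Q}_{W_a}^*$, different $\varphi$ have different extensions, and, $\hat{\mathbf D}_{W_a}^*$ being identified in this way with a subset of $\hat{\mathcal Q}_{W_a}^*$, $$\hat{\mathbf D}_{W_a}^*=\{f\in\hat{\mathcal Q}_{W_a}^*\ \mid\ f(\eta_w)\in\hat S\ \text{ and }\ f(\eta_w-\eta_{s_\alpha w})\in x_\alpha\hat S\ \text{ for all }\alpha\in\Phi_a,\ w\in W_a\}.$$ -/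

import Mathlib

noncomputable section

namespace BigTorus

/-! ### The formal group algebra of a lattice -/

section FormalGroupAlgebra

open MvPowerSeries

/-- `R[[x_M]]`: the completion of the polynomial ring `R[x_μ | μ ∈ M]` at the ideal generated by all
variables.  Its elements are the power series having only finitely many monomials in each degree
(that is, formal sums `∑_d p_d` with `p_d` a homogeneous polynomial of degree `d`); for infinite `M`
it is smaller than the ring of all power series. -/
def CompletedPoly (R : Type*) [CommRing R] (M : Type*) : Subalgebra R (MvPowerSeries M R) where
  carrier := {f | ∀ d : ℕ, {e : M →₀ ℕ | e.degree ≤ d ∧ coeff e f ≠ 0}.Finite}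
  mul_mem' := by
    classical
    intro f g hf hg d
    refine ((hf d).image2 (fun a b => a + b) (hg d)).subset ?_
    rintro e ⟨hd, he⟩
    rw [coeff_mul] at he
    obtain ⟨p, hp, hne⟩ := Finset.exists_ne_zero_of_sum_ne_zero he
    have hpe : p.1 + p.2 = e := by simpa using hp
    have hdeg : p.1.degree + p.2.degree ≤ d := by
      rw [← map_add, hpe]; exact hd
    exact ⟨p.1, ⟨by omega, left_ne_zero_of_mul hne⟩, p.2,
      ⟨by omega, right_ne_zero_of_mul hne⟩, hpe⟩
  add_mem' := by
    intro f g hf hg d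
    refine ((hf d).union (hg d)).subset ?_
    rintro e ⟨hd, he⟩
    by_cases h : coeff e f = 0
    · right
      refine ⟨hd, fun h' => he ?_⟩
      rw [map_add, h, h', add_zero]
    · exact Or.inl ⟨hd, h⟩
  algebraMap_mem' := by
    classical
    intro r d
    refine (Set.finite_singleton (0 : M →₀ ℕ)).subset ?_
    rintro e ⟨-, he⟩
    by_contra h
    apply he
    rw [MvPowerSeries.algebraMap_apply, Algebra.algebraMap_self_apply, coeff_C, if_neg (by simpa using h)]

theorem X_mem_completedPoly (R : Type*) [CommRing R] {M : Type*} (μ : M) :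
    (X μ : MvPowerSeries M R) ∈ CompletedPoly R M := by
  classical
  intro d
  refine (Set.finite_singleton (Finsupp.single μ 1)).subset ?_
  rintro e ⟨-, he⟩
  by_contra h
  exact he (by rw [coeff_X, if_neg (by simpa using h)])

/-- The variable `x_μ` of `R[[x_M]]`. -/
def var (R : Type*) [CommRing R] {M : Type*} (μ : M) : CompletedPoly R M :=
  ⟨X μ, X_mem_completedPoly R μ⟩

theorem prod_pair_eq {R : Type*} [CommRing R] {M : Type*} (μ ν : M) (d : Fin 2 →₀ ℕ) :
    (d.prod fun s e => ((![X μ, X ν] : Fin 2 → MvPowerSeries M R) s) ^ e) =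
      monomial (Finsupp.single μ (d 0) + Finsupp.single ν (d 1)) (1 : R) := by
  rw [Finsupp.prod_fintype _ _ (by simp)]
  simp [Fin.prod_univ_two, X_pow_eq, monomial_mul_monomial]

theorem subst_mem_completedPoly {R : Type*} [CommRing R] {M : Type*}
    (F : MvPowerSeries (Fin 2) R) (μ ν : M) :
    F.subst (![X μ, X ν] : Fin 2 → MvPowerSeries M R) ∈ CompletedPoly R M := by
  classical
  intro n
  refine (((Set.finite_Iic n).prod (Set.finite_Iic n)).image
    (fun p : ℕ × ℕ => Finsupp.single μ p.1 + Finsupp.single ν p.2)).subset ?_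
  rintro e ⟨hd, he⟩
  rw [coeff_subst HasSubst.X_X] at he
  obtain ⟨d, hne⟩ := not_forall.1 fun hall => he ((finsum_congr hall).trans finsum_zero)
  rw [prod_pair_eq, coeff_monomial] at hne
  by_cases h : e = Finsupp.single μ (d 0) + Finsupp.single ν (d 1)
  · have hdeg : d 0 + d 1 ≤ n := by
      simpa [h, Finsupp.degree_single] using hd
    exact ⟨(d 0, d 1), ⟨by simp; omega, by simp; omega⟩, h.symm⟩
  · simp [h] at hne

/-- The element `F(x_μ, x_ν)` of `R[[x_M]]`. -/
def formalSum {R : Type*} [CommRing R] (F : FormalGroup R) {M : Type*} (μ ν : M) :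
    CompletedPoly R M :=
  ⟨F.toPowerSeries.subst ![X μ, X ν], subst_mem_completedPoly F.toPowerSeries μ ν⟩

/-- The ideal of the series in `R[[x_M]]` of order at least `n`; these ideals are a basis of
neighbourhoods of `0`. -/
def orderIdeal (R : Type*) [CommRing R] (M : Type*) (n : ℕ) : Ideal (CompletedPoly R M) where
  carrier := {f | ∀ e : M →₀ ℕ, e.degree < n → coeff e (f : MvPowerSeries M R) = 0}
  add_mem' := by
    intro f g hf hg e he
    simp [hf e he, hg e he]
  zero_mem' := by
    intro e _
    simp
  smul_mem' := by
    classical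
    intro c f hf e he
    simp only [smul_eq_mul, MulMemClass.coe_mul, coeff_mul]
    refine Finset.sum_eq_zero fun p hp => ?_
    have hpe : p.1 + p.2 = e := by simpa using hp
    have hdeg : p.1.degree + p.2.degree = e.degree := by rw [← map_add, hpe]
    rw [hf p.2 (by omega), mul_zero]

/-- The ideal generated by `x_0` and all `x_{μ+ν} - F(x_μ, x_ν)`. -/
def relIdeal {R : Type*} [CommRing R] (F : FormalGroup R) (M : Type*) [AddCommGroup M] :
    Ideal (CompletedPoly R M) :=
  Ideal.span ({var R (0 : M)} ∪ {z | ∃ μ ν : M, z = var R (μ + ν) - formalSum F μ ν})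

/-- The ideal `𝒥_F`: the topological closure of `relIdeal F M`. -/
def closedRelIdeal {R : Type*} [CommRing R] (F : FormalGroup R) (M : Type*) [AddCommGroup M] :
    Ideal (CompletedPoly R M) :=
  ⨅ n : ℕ, relIdeal F M ⊔ orderIdeal R M n

/-- The formal group algebra `R[[x_μ | μ ∈ M]] / 𝒥_F` of the lattice `M`. -/
def FGAlg {R : Type*} [CommRing R] (F : FormalGroup R) (M : Type*) [AddCommGroup M] : Type _ :=
  CompletedPoly R M ⧸ closedRelIdeal F M

instance {R : Type*} [CommRing R] (F : FormalGroup R) (M : Type*) [AddCommGroup M] :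
    CommRing (FGAlg F M) :=
  Ideal.Quotient.commRing (closedRelIdeal F M)

/-- The projection `R[[x_M]] → R[[x_M]] / 𝒥_F`. -/
def fgMk {R : Type*} [CommRing R] (F : FormalGroup R) (M : Type*) [AddCommGroup M] :
    CompletedPoly R M →+* FGAlg F M :=
  Ideal.Quotient.mk (closedRelIdeal F M)

theorem fgMk_surjective {R : Type*} [CommRing R] (F : FormalGroup R) (M : Type*)
    [AddCommGroup M] : Function.Surjective (fgMk F M) :=
  Ideal.Quotient.mk_surjective

/-- The class of `x_μ` in the formal group algebra. -/
def xElt {R : Type*} [CommRing R] (F : FormalGroup R) {M : Type*} [AddCommGroup M] (μ : M) :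
    FGAlg F M :=
  fgMk F M (var R μ)

/-! The action of a group `G` on a lattice `M` induces one on the formal group algebra, by
`g • x_μ = x_{g • μ}`. -/

theorem coeff_renameEquiv {R : Type*} [CommRing R] {M : Type*} (σ : M ≃ M)
    (f : MvPowerSeries M R) (e : M →₀ ℕ) :
    coeff (e.mapDomain σ) (renameEquiv R σ f) = coeff e f := by
  have h := coeff_embDomain_rename σ.toEmbedding f e
  rw [Finsupp.embDomain_eq_mapDomain] at h
  exact h

theorem coeff_renameEquiv' {R : Type*} [CommRing R] {M : Type*} (σ : M ≃ M)
    (f : MvPowerSeries M R) (e : M →₀ ℕ) :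
    coeff e (renameEquiv R σ f) = coeff (e.mapDomain σ.symm) f := by
  rw [← coeff_renameEquiv σ f, ← Finsupp.mapDomain_comp]
  simp

theorem degree_mapDomain {M : Type*} (σ : M ≃ M) (e : M →₀ ℕ) :
    (e.mapDomain σ).degree = e.degree := by
  classical
  induction e using Finsupp.induction_linear with
  | zero => simp
  | add f g hf hg => rw [Finsupp.mapDomain_add, map_add, map_add, hf, hg]
  | single a b => simp [Finsupp.mapDomain_single, Finsupp.degree_single]

theorem rename_mem_completedPoly {R : Type*} [CommRing R] {M : Type*} (σ : M ≃ M)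
    {f : MvPowerSeries M R} (hf : f ∈ CompletedPoly R M) :
    renameEquiv R σ f ∈ CompletedPoly R M := by
  intro d
  refine ((hf d).image (fun e => e.mapDomain σ)).subset ?_
  rintro e ⟨hd, he⟩
  rw [coeff_renameEquiv'] at he
  refine ⟨e.mapDomain σ.symm, ⟨by rwa [degree_mapDomain], he⟩, ?_⟩
  simp [← Finsupp.mapDomain_comp]

/-- Permutation of the variables of `R[[x_M]]`: `x_μ ↦ x_{σ μ}`. -/
def permHom (R : Type*) [CommRing R] {M : Type*} (σ : M ≃ M) :
    CompletedPoly R M →+* CompletedPoly R M :=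
  ((renameEquiv R σ : MvPowerSeries M R →+* MvPowerSeries M R).comp
    (CompletedPoly R M).val.toRingHom).codRestrict (CompletedPoly R M)
    (fun f => rename_mem_completedPoly σ f.2)

theorem coe_permHom {R : Type*} [CommRing R] {M : Type*} (σ : M ≃ M) (f : CompletedPoly R M) :
    (permHom R σ f : MvPowerSeries M R) = renameEquiv R σ f := rfl

theorem permHom_var {R : Type*} [CommRing R] {M : Type*} (σ : M ≃ M) (μ : M) :
    permHom R σ (var R μ) = var R (σ μ) := by
  apply Subtype.ext
  rw [coe_permHom]
  exact rename_X (R := R) σ μ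

theorem permHom_formalSum {R : Type*} [CommRing R] (F : FormalGroup R) {M : Type*} (σ : M ≃ M)
    (μ ν : M) : permHom R σ (formalSum F μ ν) = formalSum F (σ μ) (σ ν) := by
  classical
  apply Subtype.ext
  rw [coe_permHom]
  ext e
  rw [coeff_renameEquiv']
  simp only [formalSum]
  rw [coeff_subst HasSubst.X_X, coeff_subst HasSubst.X_X]
  refine finsum_congr fun d => ?_
  rw [prod_pair_eq, prod_pair_eq, coeff_monomial, coeff_monomial]
  congr 1
  have : (Finsupp.mapDomain σ.symm e = Finsupp.single μ (d 0) + Finsupp.single ν (d 1)) ↔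
      (e = Finsupp.single (σ μ) (d 0) + Finsupp.single (σ ν) (d 1)) := by
    constructor
    · intro h
      have h2 := congrArg (Finsupp.mapDomain σ) h
      rw [← Finsupp.mapDomain_comp, Finsupp.mapDomain_add] at h2
      simpa [Finsupp.mapDomain_single] using h2
    · rintro rfl
      simp [Finsupp.mapDomain_add, Finsupp.mapDomain_single]
  simp only [this]

theorem permHom_mem_closedRelIdeal {R : Type*} [CommRing R] (F : FormalGroup R) {M : Type*}
    [AddCommGroup M] (σ : M ≃+ M) :
    closedRelIdeal F M ≤ (closedRelIdeal F M).comap (permHom R σ.toEquiv) := by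
  have hrel : relIdeal F M ≤ (relIdeal F M).comap (permHom R σ.toEquiv) := by
    refine Ideal.span_le.2 ?_
    rintro z (rfl | ⟨μ, ν, rfl⟩)
    · refine Ideal.subset_span (Or.inl ?_)
      rw [permHom_var]
      simp
    · refine Ideal.subset_span (Or.inr ⟨σ μ, σ ν, ?_⟩)
      rw [map_sub, permHom_var, permHom_formalSum]
      simp
  have hord : ∀ n, orderIdeal R M n ≤ (orderIdeal R M n).comap (permHom R σ.toEquiv) := by
    intro n f hf e he
    rw [coe_permHom, coeff_renameEquiv']
    exact hf _ (by rwa [degree_mapDomain])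
  intro f hf
  rw [Ideal.mem_comap, closedRelIdeal, Ideal.mem_iInf]
  intro n
  have hn : f ∈ relIdeal F M ⊔ orderIdeal R M n := by
    rw [closedRelIdeal, Ideal.mem_iInf] at hf
    exact hf n
  exact (sup_le (hrel.trans (Ideal.comap_mono le_sup_left))
    ((hord n).trans (Ideal.comap_mono le_sup_right)) :
    relIdeal F M ⊔ orderIdeal R M n ≤ _) hn

/-- The endomorphism `x_μ ↦ x_{σ μ}` of the formal group algebra. -/
def latticeHom {R : Type*} [CommRing R] (F : FormalGroup R) {M : Type*} [AddCommGroup M]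
    (σ : M ≃+ M) : FGAlg F M →+* FGAlg F M :=
  Ideal.quotientMap (closedRelIdeal F M) (permHom R σ.toEquiv) (permHom_mem_closedRelIdeal F σ)

theorem latticeHom_mk {R : Type*} [CommRing R] (F : FormalGroup R) {M : Type*} [AddCommGroup M]
    (σ : M ≃+ M) (f : CompletedPoly R M) :
    latticeHom F σ (fgMk F M f) = fgMk F M (permHom R σ.toEquiv f) := rfl

theorem latticeHom_xElt {R : Type*} [CommRing R] (F : FormalGroup R) {M : Type*} [AddCommGroup M]
    (σ : M ≃+ M) (μ : M) : latticeHom F σ (xElt F μ) = xElt F (σ μ) := by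
  rw [xElt, latticeHom_mk, permHom_var]
  rfl

instance fgAlgAction {R : Type*} [CommRing R] (F : FormalGroup R) {M : Type*} [AddCommGroup M]
    {G : Type*} [Group G] [DistribMulAction G M] : MulSemiringAction G (FGAlg F M) where
  smul g := latticeHom F (DistribMulAction.toAddEquiv M g)
  one_smul s := by
    obtain ⟨f, rfl⟩ := fgMk_surjective F M s
    refine (latticeHom_mk F _ f).trans (congrArg (fgMk F M) (Subtype.ext ?_))
    have h : (DistribMulAction.toAddEquiv M (1 : G)).toEquiv = Equiv.refl M := by
      ext μ
      simp
    rw [coe_permHom, h, renameEquiv_refl]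
    rfl
  mul_smul g h s := by
    obtain ⟨f, rfl⟩ := fgMk_surjective F M s
    refine (latticeHom_mk F _ f).trans (congrArg (fgMk F M) (Subtype.ext ?_))
    have hgh : (DistribMulAction.toAddEquiv M (g * h)).toEquiv =
        (DistribMulAction.toAddEquiv M h).toEquiv.trans
          (DistribMulAction.toAddEquiv M g).toEquiv := by
      ext μ
      simp [mul_smul]
    rw [coe_permHom, coe_permHom, coe_permHom, hgh, ← renameEquiv_trans]
    rfl
  smul_zero g := map_zero (latticeHom F (DistribMulAction.toAddEquiv M g))
  smul_add g := map_add (latticeHom F (DistribMulAction.toAddEquiv M g))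
  smul_one g := map_one (latticeHom F (DistribMulAction.toAddEquiv M g))
  smul_mul g := map_mul (latticeHom F (DistribMulAction.toAddEquiv M g))

theorem smul_xElt {R : Type*} [CommRing R] (F : FormalGroup R) {M : Type*} [AddCommGroup M]
    {G : Type*} [Group G] [DistribMulAction G M] (g : G) (μ : M) :
    g • xElt F μ = xElt F (g • μ) := latticeHom_xElt F _ μ

end FormalGroupAlgebra

/-! ### The affine root system and the affine Weyl group

`P` is a root datum with character lattice `X = T^*` and cocharacter lattice `Y`.  The character
lattice `T_a^* = T^* ⊕ ℤδ` of the big torus is `X × ℤ`, with `(μ, m)` standing for `μ + mδ`. -/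

section AffineWeyl

variable {ι X Y : Type*} [AddCommGroup X] [AddCommGroup Y]

/-- The root system is nonempty and is not the union of two nonempty mutually orthogonal parts. -/
def IsSimpleDatum (P : RootDatum ι X Y) : Prop :=
  Nonempty ι ∧ ∀ s : Set ι, s.Nonempty → (∀ i ∈ s, ∀ j ∉ s, P.pairing i j = 0) → s = Set.univ

/-- The coroots span the cocharacter lattice; equivalently, the character lattice is the
weight lattice. -/
def IsSimplyConnectedDatum (P : RootDatum ι X Y) : Prop :=
  P.corootSpan ℤ = ⊤

/-- `θ` is the highest root with respect to the base `b`. -/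
def IsHighestRoot (P : RootDatum ι X Y) (b : P.Base) (θ : ι) : Prop :=
  ∀ i, P.root θ - P.root i ∈ AddSubmonoid.closure (P.root '' b.support)

/-- The real affine root `α + kδ`, where `a = (i, k)` and `α` is the `i`-th root. -/
def affRoot (P : RootDatum ι X Y) (a : ι × ℤ) : X × ℤ := (P.root a.1, a.2)

/-- The functional `μ + mδ ↦ ⟨μ, α^∨⟩`. -/
def affCoroot (P : RootDatum ι X Y) (a : ι × ℤ) : Module.Dual ℤ (X × ℤ) :=
  (P.coroot' a.1).comp (LinearMap.fst ℤ X ℤ)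

theorem affCoroot_affRoot (P : RootDatum ι X Y) (a : ι × ℤ) :
    affCoroot P a (affRoot P a) = 2 := by
  simp [affCoroot, affRoot]

/-- The reflection `s_{α+kδ}(μ + mδ) = μ + mδ - ⟨μ, α^∨⟩ (α + kδ)`. -/
def affReflection (P : RootDatum ι X Y) (a : ι × ℤ) : (X × ℤ) ≃ₗ[ℤ] (X × ℤ) :=
  Module.reflection (affCoroot_affRoot P a)

/-- The translation `t_λ(μ + mδ) = μ + (m - ⟨μ, λ⟩)δ`. -/
def translation (P : RootDatum ι X Y) (l : Y) : (X × ℤ) ≃ₗ[ℤ] (X × ℤ) where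
  toFun v := (v.1, v.2 - P.toLinearMap v.1 l)
  invFun v := (v.1, v.2 + P.toLinearMap v.1 l)
  map_add' v w := by
    ext
    · simp
    · simp; ring
  map_smul' c v := by
    ext
    · simp
    · simp; ring
  left_inv v := by simp
  right_inv v := by simp

/-- The affine Weyl group `W_a = W ⋉ Q^∨`, as the group of automorphisms of `T^* ⊕ ℤδ` generated by
the reflections `s_α`, `α ∈ Φ`, and the translations `t_λ`, `λ ∈ Q^∨`. -/
def affWeyl (P : RootDatum ι X Y) : Subgroup ((X × ℤ) ≃ₗ[ℤ] (X × ℤ)) :=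
  Subgroup.closure (Set.range (fun i : ι => affReflection P (i, 0)) ∪
    translation P '' (P.corootSpan ℤ : Set Y))

theorem affReflection_eq (P : RootDatum ι X Y) (i : ι) (k : ℤ) :
    affReflection P (i, k) = affReflection P (i, 0) * translation P (k • P.coroot i) := by
  ext v
  · simp [affReflection, Module.reflection_apply, translation, affCoroot, affRoot,
      RootPairing.coroot']
  · simp [affReflection, Module.reflection_apply, translation, affCoroot, affRoot, mul_comm,
      RootPairing.coroot']

theorem affReflection_mem (P : RootDatum ι X Y) (a : ι × ℤ) : affReflection P a ∈ affWeyl P := by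
  obtain ⟨i, k⟩ := a
  rw [affReflection_eq]
  refine mul_mem (Subgroup.subset_closure (Or.inl ⟨i, rfl⟩)) (Subgroup.subset_closure (Or.inr ?_))
  exact ⟨_, Submodule.smul_mem _ _ (Submodule.subset_span ⟨i, rfl⟩), rfl⟩

/-- The reflection `s_{α+kδ}` as an element of `W_a`. -/
def sRefl (P : RootDatum ι X Y) (a : ι × ℤ) : affWeyl P :=
  ⟨affReflection P a, affReflection_mem P a⟩

theorem affReflection_affRoot (P : RootDatum ι X Y) (i : ι) (a : ι × ℤ) :
    affReflection P (i, 0) (affRoot P a) ∈ Set.range (affRoot P) := by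
  refine ⟨(P.reflectionPerm i a.1, a.2), ?_⟩
  ext
  · simp [affReflection, Module.reflection_apply, affRoot, affCoroot, ← P.reflectionPerm_root,
      RootPairing.coroot']
  · simp [affReflection, Module.reflection_apply, affRoot]

theorem affWeyl_smul_affRoot (P : RootDatum ι X Y) (w : affWeyl P) (a : ι × ℤ) :
    w • affRoot P a ∈ Set.range (affRoot P) := by
  obtain ⟨w, hw⟩ := w
  change w (affRoot P a) ∈ Set.range (affRoot P)
  induction hw using Subgroup.closure_induction'' generalizing a with
  | one => exact ⟨a, rfl⟩
  | mul g h _ _ ihg ihh =>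
    obtain ⟨c, hc⟩ := ihh a
    have := ihg c
    rwa [hc] at this
  | mem g hg =>
    rcases hg with ⟨i, rfl⟩ | ⟨l, -, rfl⟩
    · exact affReflection_affRoot P i a
    · exact ⟨(a.1, a.2 - P.toLinearMap (P.root a.1) l), rfl⟩
  | inv_mem g hg =>
    rcases hg with ⟨i, rfl⟩ | ⟨l, -, rfl⟩
    · have h : (affReflection P (i, 0))⁻¹ = affReflection P (i, 0) := Module.reflection_symm _
      rw [h]
      exact affReflection_affRoot P i a
    · exact ⟨(a.1, a.2 + P.toLinearMap (P.root a.1) l), rfl⟩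

/-- The simple affine roots `α_1, …, α_n` and `α_0 = -θ + δ`.  (`P.reflectionPerm θ θ` is the
index of `-θ`.) -/
def simpleAff (P : RootDatum ι X Y) (b : P.Base) (θ : ι) : Set (ι × ℤ) :=
  {a | a.1 ∈ b.support ∧ a.2 = 0} ∪ {(P.reflectionPerm θ θ, 1)}

end AffineWeyl

/-! ### The localized twisted group algebra and the formal affine Demazure algebra -/

section Demazure

variable {R : Type*} [CommRing R] (F : FormalGroup R)
variable {ι X Y : Type*} [AddCommGroup X] [AddCommGroup Y] (P : RootDatum ι X Y)

/-- The formal group algebra `Ŝ` of `T_a^* = T^* ⊕ ℤδ`. -/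
abbrev SHat (F : FormalGroup R) (_P : RootDatum ι X Y) : Type _ := FGAlg F (X × ℤ)

/-- The element `x_α` of `Ŝ`, for a real affine root `α`. -/
def xRoot (a : ι × ℤ) : SHat F P := xElt F (affRoot P a)

/-- The multiplicative set generated by the `x_α`, for `α` a real affine root. -/
def rootSubmonoid : Submonoid (SHat F P) := Submonoid.closure (Set.range (xRoot F P))

/-- `Q̂ = Ŝ[1/x_α | α ∈ Φ_a]`. -/
abbrev QHat : Type _ := Localization (rootSubmonoid F P)

theorem rootSubmonoid_le_comap (w : affWeyl P) :
    rootSubmonoid F P ≤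
      (rootSubmonoid F P).comap (MulSemiringAction.toRingHom (affWeyl P) (SHat F P) w) := by
  refine (Submonoid.closure_le).2 ?_
  rintro _ ⟨a, rfl⟩
  obtain ⟨c, hc⟩ := affWeyl_smul_affRoot P w a
  refine Submonoid.subset_closure ⟨c, ?_⟩
  change xElt F (affRoot P c) = w • xElt F (affRoot P a)
  rw [hc]
  exact (smul_xElt F w (affRoot P a)).symm

/-- The action of `w ∈ W_a` on `Q̂`. -/
def qHom (w : affWeyl P) : QHat F P →+* QHat F P :=
  IsLocalization.map (QHat F P) (MulSemiringAction.toRingHom (affWeyl P) (SHat F P) w)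
    (rootSubmonoid_le_comap F P w)

theorem qHom_algebraMap (w : affWeyl P) (s : SHat F P) :
    qHom F P w (algebraMap _ _ s) = algebraMap _ _ (w • s) :=
  IsLocalization.map_eq _ _

instance qAction : MulSemiringAction (affWeyl P) (QHat F P) where
  smul w := qHom F P w
  one_smul q := by
    have h : qHom F P 1 = RingHom.id _ :=
      IsLocalization.ringHom_ext (rootSubmonoid F P) (RingHom.ext fun s => by
        simp [qHom_algebraMap])
    exact congrArg (fun g => g q) h
  mul_smul v w q := by
    have h : qHom F P (v * w) = (qHom F P v).comp (qHom F P w) :=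
      IsLocalization.ringHom_ext (rootSubmonoid F P) (RingHom.ext fun s => by
        simp [qHom_algebraMap, mul_smul])
    exact congrArg (fun g => g q) h
  smul_zero w := map_zero (qHom F P w)
  smul_add w := map_add (qHom F P w)
  smul_one w := map_one (qHom F P w)
  smul_mul w := map_mul (qHom F P w)

/-- The twisted group algebra `Q̂_{W_a} = Q̂ ⋊ R[W_a]`: the free left `Q̂`-module with basis `η_w` and
product `(c η_w)(c' η_{w'}) = c w(c') η_{w w'}`. -/
abbrev QW : Type _ := SkewMonoidAlgebra (QHat F P) (affWeyl P)

/-- The basis element `η_w`. -/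
def eta (w : affWeyl P) : QW F P := SkewMonoidAlgebra.single w 1

/-- `1 / x_α ∈ Q̂`. -/
def invX (a : ι × ℤ) : QHat F P :=
  Localization.mk 1 ⟨xRoot F P a, Submonoid.subset_closure ⟨a, rfl⟩⟩

/-- The Demazure element `X̂_α = (1 / x_α) (1 - η_{s_α})`. -/
def demazure (a : ι × ℤ) : QW F P := invX F P a • (1 - eta F P (sRefl P a))

/-- The formal affine Demazure algebra `D̂_{W_a}` as a subring of `Q̂_{W_a}`: it is generated by `Ŝ`
and the Demazure elements of the simple affine roots. -/
def fadaRing (b : P.Base) (θ : ι) : Subring (QW F P) :=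
  Subring.closure (Set.range (fun s : SHat F P => s • (1 : QW F P)) ∪
    demazure F P '' simpleAff P b θ)

/-- `D̂_{W_a}` as a left `Ŝ`-module. -/
def fada (b : P.Base) (θ : ι) : Submodule (SHat F P) (QW F P) where
  carrier := fadaRing F P b θ
  add_mem' := add_mem
  zero_mem' := zero_mem _
  smul_mem' s z hz := by
    have h : s • z = (s • (1 : QW F P)) * z := by
      have h1 : (s • (1 : QW F P)) = SkewMonoidAlgebra.single 1 (s • (1 : QHat F P)) := by
        rw [SkewMonoidAlgebra.one_def, SkewMonoidAlgebra.smul_single]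
      rw [h1]
      clear hz
      induction z using SkewMonoidAlgebra.induction_on' with
      | single w q => simp [SkewMonoidAlgebra.smul_single, SkewMonoidAlgebra.single_mul_single]
      | add f g hf hg => rw [smul_add, mul_add, hf, hg]
    rw [h]
    exact mul_mem (Subring.subset_closure (Or.inl ⟨s, rfl⟩)) hz

/-- `Q̂_{W_a}^* = Hom_Q̂(Q̂_{W_a}, Q̂)`. -/
abbrev QWDual : Type _ := QW F P →ₗ[QHat F P] QHat F P

/-- The `Q̂`-linear functional `f` on `Q̂_{W_a}` extends the `Ŝ`-linear functional `φ : D̂_{W_a} → Ŝ`. -/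
def Extends (b : P.Base) (θ : ι) (φ : fada F P b θ →ₗ[SHat F P] SHat F P) (f : QWDual F P) : Prop :=
  ∀ z : fada F P b θ, f (z : QW F P) = algebraMap (SHat F P) (QHat F P) (φ z)

/-- The dual `D̂_{W_a}^* = Hom_Ŝ(D̂_{W_a}, Ŝ)`, viewed inside `Q̂_{W_a}^*` through the `Q̂`-linear
extension of functionals. -/
def fadaDual (b : P.Base) (θ : ι) : Set (QWDual F P) :=
  {f | ∃ φ : fada F P b θ →ₗ[SHat F P] SHat F P, Extends F P b θ φ f}

/-- The big-torus GKM condition: `f(η_w) ∈ Ŝ` for all `w ∈ W_a`, and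
`f(η_w - η_{s_α w}) ∈ x_α Ŝ` for all real affine roots `α` and all `w ∈ W_a`. -/
def gkmSet : Set (QWDual F P) :=
  {f | (∀ w, ∃ s : SHat F P, f (eta F P w) = algebraMap (SHat F P) (QHat F P) s) ∧
    ∀ (a : ι × ℤ) (w : affWeyl P), ∃ s : SHat F P,
      f (eta F P w - eta F P (sRefl P a * w)) =
        algebraMap (SHat F P) (QHat F P) (xRoot F P a * s)}

/-- `x_α` and `x_β` are coprime in `Ŝ`: `x_α ∣ x_β g` implies `x_α ∣ g`. -/
def CoprimeRoots (a c : ι × ℤ) : Prop :=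
  ∀ g : SHat F P, xRoot F P a ∣ xRoot F P c * g → xRoot F P a ∣ g

end Demazure

end BigTorus

end

/-! The elements `η_w` are a `Q̂`-basis of the localized algebra and all lie in `D̂` (`eta_mem`):
the simple affine reflections generate `W_a`, and `η_s = 1 - x_α X̂_α` for `s` the reflection in a
simple `α`. Every element of `Q̂_{W_a}` becomes an `Ŝ`-combination of the `η_w` after multiplication
by a product of the `x_α`. A functional on `D̂` is therefore governed by its values on the `η_w`,
which gives existence and uniqueness of the extension (`existsUnique_extends`); injectivity of `Ŝ →
Q̂` recovers the functional from it.

Functionals on `D̂` satisfy the GKM condition because `X̂_α` lies in `D̂` for every real affine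
root: each such root is conjugate to a simple one (`affRoot_induction`) and conjugation by `η_w`
carries `X̂_α` to `X̂_{wα}`. The divisibility then follows from `x_α X̂_α η_w = η_w - η_{s_α w}`.

Conversely, the GKM functionals are stable under `f ↦ f(· z)` for `z ∈ D̂`
(`comp_mulRight_mem_gkmSet`), and evaluating at `η_1` shows `f(z) ∈ Ŝ`. For `z ∈ Ŝ` stability rests
on `x_α ∣ s - s_α(s)`. For `z` a Demazure element it says that divided differences of a GKM family
are again GKM (`IsGKM.divided_difference`). There one must cancel `x_β` from a divisibility by
`x_α`, so `x_α` and `x_β` have to be coprime for `β ≠ ±α`.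

Coprimality (`coprimeRoots`) comes from the structure of `Ŝ`: a basis of the lattice identifies it
with a power series ring (`fgEquiv`), a basis vector becoming a variable. Since a coroot takes the
value 2 on its root, a real affine root is primitive or twice a primitive vector. In the primitive
case `x_α` is a variable in suitable coordinates, hence prime; if 2 is invertible, `x_{2v}` and
`x_v` are associates; what remains is the coprimality assumption of the theorem. -/

noncomputable section

namespace BigTorus

open MvPowerSeries

/-! ### Power series filtered by order -/

section OrderFiltration

variable {R : Type*} [CommRing R] {σ : Type*}

/-- The ideal of power series all of whose terms have degree at least `n`. -/
def ordGE (R : Type*) [CommRing R] (σ : Type*) (n : ℕ) : Ideal (MvPowerSeries σ R) where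
  carrier := {f | ∀ e : σ →₀ ℕ, e.degree < n → coeff e f = 0}
  add_mem' := by
    intro f g hf hg e he
    simp [hf e he, hg e he]
  zero_mem' := by
    intro e _
    simp
  smul_mem' := by
    classical
    intro c f hf e he
    simp only [smul_eq_mul, coeff_mul]
    refine Finset.sum_eq_zero fun p hp => ?_
    have hpe : p.1 + p.2 = e := by simpa using hp
    have hdeg : p.1.degree + p.2.degree = e.degree := by rw [← map_add, hpe]
    rw [hf p.2 (by omega), mul_zero]

theorem ordGE_anti {m n : ℕ} (h : m ≤ n) : ordGE R σ n ≤ ordGE R σ m :=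
  fun _ hf e he => hf e (he.trans_le h)

theorem mem_ordGE_one {f : MvPowerSeries σ R} : f ∈ ordGE R σ 1 ↔ constantCoeff f = 0 := by
  constructor
  · intro h
    exact h 0 (by simp)
  · intro h e he
    obtain rfl : e = 0 := (Finsupp.degree_eq_zero_iff e).1 (by omega)
    exact h

theorem mul_mem_ordGE {m n : ℕ} {f g : MvPowerSeries σ R} (hf : f ∈ ordGE R σ m)
    (hg : g ∈ ordGE R σ n) : f * g ∈ ordGE R σ (m + n) := by
  classical
  intro e he
  rw [coeff_mul]
  refine Finset.sum_eq_zero fun p hp => ?_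
  have hpe : p.1 + p.2 = e := by simpa using hp
  have hdeg : p.1.degree + p.2.degree = e.degree := by rw [← map_add, hpe]
  rcases lt_or_ge p.1.degree m with h | h
  · rw [hf p.1 h, zero_mul]
  · rw [hg p.2 (by omega), mul_zero]

theorem eq_zero_of_forall_mem_ordGE {f : MvPowerSeries σ R} (h : ∀ n, f ∈ ordGE R σ n) : f = 0 := by
  ext e
  exact h (e.degree + 1) e (Nat.lt_succ_self _)

theorem pow_mem_ordGE {f : MvPowerSeries σ R} (hf : f ∈ ordGE R σ 1) (n : ℕ) :
    f ^ n ∈ ordGE R σ n := by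
  induction n with
  | zero => intro e he; omega
  | succ n ih => rw [pow_succ]; exact mul_mem_ordGE ih hf

theorem finsuppProd_mem_ordGE {τ : Type*} {a : σ → MvPowerSeries τ R}
    (ha : ∀ s, a s ∈ ordGE R τ 1) (e : σ →₀ ℕ) :
    (e.prod fun s k => a s ^ k) ∈ ordGE R τ e.degree := by
  classical
  induction e using Finsupp.induction_linear with
  | zero => intro d hd; simp at hd
  | add f g hf hg =>
    rw [Finsupp.prod_add_index' (by simp) (by intros; rw [pow_add]), map_add]
    exact mul_mem_ordGE hf hg
  | single s k =>
    rw [Finsupp.prod_single_index (by simp), Finsupp.degree_single]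
    exact pow_mem_ordGE (ha s) k

theorem aeval_mem_ordGE {τ : Type*} {a : σ → MvPowerSeries τ R} (ha : ∀ s, a s ∈ ordGE R τ 1)
    {n : ℕ} {p : MvPolynomial σ R} (hp : (p : MvPowerSeries σ R) ∈ ordGE R σ n) :
    MvPolynomial.aeval a p ∈ ordGE R τ n := by
  rw [MvPolynomial.aeval_def, MvPolynomial.eval₂_eq]
  refine sum_mem fun d hd => ?_
  have hdn : n ≤ d.degree := by
    by_contra hlt
    have := hp d (not_le.1 hlt)
    rw [MvPolynomial.coeff_coe] at this
    exact (MvPolynomial.mem_support_iff.1 hd) this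
  refine Ideal.mul_mem_left _ _ (ordGE_anti hdn ?_)
  exact finsuppProd_mem_ordGE ha d

theorem subst_mem_ordGE {τ : Type*} {a : σ → MvPowerSeries τ R} (hs : HasSubst a)
    (ha : ∀ s, a s ∈ ordGE R τ 1) {n : ℕ} {f : MvPowerSeries σ R} (hf : f ∈ ordGE R σ n) :
    f.subst a ∈ ordGE R τ n := by
  intro e he
  rw [coeff_subst hs]
  refine (finsum_congr fun d => ?_).trans finsum_zero
  rcases lt_or_ge d.degree n with h | h
  · rw [hf d h, zero_smul]
  · rw [finsuppProd_mem_ordGE ha d e (he.trans_le h), smul_zero]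

/-- Completeness: a coherent sequence of approximations has a limit. -/
theorem exists_limit_ordGE {k : ℕ} (v : ℕ → MvPowerSeries σ R)
    (hv : ∀ n, v (n + 1) - v n ∈ ordGE R σ (n - k)) :
    ∃ w, ∀ n, w - v n ∈ ordGE R σ (n - k) := by
  have hmono : ∀ n m, v (n + m) - v n ∈ ordGE R σ (n - k) := by
    intro n m
    induction m with
    | zero => simp
    | succ m ih =>
      have := add_mem (ordGE_anti (by omega : n - k ≤ n + m - k) (hv (n + m))) ih
      rwa [sub_add_sub_cancel] at this
  -- The index `e.degree + 1 + k` is the first one at which the sequence is stable in degree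
  -- `e.degree`; `k` is the number of degrees lost in the approximation.
  obtain ⟨w, hw⟩ : ∃ w : MvPowerSeries σ R, ∀ e, coeff e w = coeff e (v (e.degree + 1 + k)) :=
    ⟨fun e => coeff e (v (e.degree + 1 + k)), fun e => rfl⟩
  refine ⟨w, fun n e he => ?_⟩
  rw [map_sub, hw]
  obtain ⟨m, rfl⟩ : ∃ m, n = e.degree + 1 + k + m := ⟨n - (e.degree + 1 + k), by omega⟩
  have := hmono (e.degree + 1 + k) m e (by omega)
  rw [map_sub, sub_eq_zero] at this
  rw [this, sub_self]

end OrderFiltration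

/-! ### Evaluating completed polynomials at series without constant term -/

section Evaluation

variable {R : Type*} [CommRing R] {M κ : Type*}

theorem mem_orderIdeal {n : ℕ} {f : CompletedPoly R M} :
    f ∈ orderIdeal R M n ↔ (f : MvPowerSeries M R) ∈ ordGE R M n := Iff.rfl

/-- Finiteness in each degree is exactly what makes the truncation a polynomial. Later identities
are checked on polynomials modulo every order. -/
theorem exists_poly_approx {f : MvPowerSeries M R} (hf : f ∈ CompletedPoly R M) (n : ℕ) :
    ∃ p : MvPolynomial M R, f - (p : MvPowerSeries M R) ∈ ordGE R M n := by
  classical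
  refine ⟨∑ e ∈ (hf n).toFinset, MvPolynomial.monomial e (coeff e f), fun e he => ?_⟩
  rw [map_sub, MvPolynomial.coeff_coe, MvPolynomial.coeff_sum]
  simp only [MvPolynomial.coeff_monomial, Finset.sum_ite_eq', Set.Finite.mem_toFinset,
    Set.mem_ofPred_eq]
  by_cases h : coeff e f = 0
  · simp [h]
  · simp [h, he.le]

theorem mem_completedPoly_of_finite [Finite κ] (f : MvPowerSeries κ R) : f ∈ CompletedPoly R κ := by
  intro d
  exact (Finsupp.finite_of_degree_le d).subset fun e he => he.1

theorem coe_mem_completedPoly (p : MvPolynomial M R) :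
    (p : MvPowerSeries M R) ∈ CompletedPoly R M := by
  intro d
  refine (Finset.finite_toSet p.support).subset ?_
  rintro e ⟨-, he⟩
  rw [MvPolynomial.coeff_coe] at he
  exact MvPolynomial.mem_support_iff.2 he

/-- Polynomials as elements of the completion. -/
def polyHom (R : Type*) [CommRing R] (M : Type*) : MvPolynomial M R →+* CompletedPoly R M :=
  MvPolynomial.coeToMvPowerSeries.ringHom.codRestrict (CompletedPoly R M) coe_mem_completedPoly

theorem coe_polyHom (p : MvPolynomial M R) : (polyHom R M p : MvPowerSeries M R) = p := rfl

theorem polyHom_X (μ : M) : polyHom R M (MvPolynomial.X μ) = var R μ :=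
  Subtype.ext (MvPolynomial.coe_X μ)

theorem exists_polyHom_approx (f : CompletedPoly R M) (n : ℕ) :
    ∃ p : MvPolynomial M R, f - polyHom R M p ∈ orderIdeal R M n :=
  exists_poly_approx f.2 n

section Eval

variable (g : M → MvPowerSeries κ R)

/-- The value at `g` of a completed polynomial; see `evalHom`. -/
def evalFun (f : CompletedPoly R M) : MvPowerSeries κ R := fun e =>
  coeff e (MvPolynomial.aeval g (exists_poly_approx f.2 (e.degree + 1)).choose)

variable {g} (hg : ∀ μ, g μ ∈ ordGE R κ 1)
include hg

/-- Substituting series without constant term cannot lower the order, so the value is independent of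
the polynomial approximation chosen. The ring axioms for `evalHom` are all deduced from this. -/
theorem evalFun_sub_aeval_mem {f : CompletedPoly R M} {n : ℕ} {p : MvPolynomial M R}
    (hp : (f : MvPowerSeries M R) - p ∈ ordGE R M n) :
    evalFun g f - MvPolynomial.aeval g p ∈ ordGE R κ n := by
  intro e he
  have h := (exists_poly_approx f.2 (e.degree + 1)).choose_spec
  set q := (exists_poly_approx f.2 (e.degree + 1)).choose with hq
  have hpq : ((q - p : MvPolynomial M R) : MvPowerSeries M R) ∈ ordGE R M (e.degree + 1) := by
    have := sub_mem (ordGE_anti (Nat.succ_le_of_lt he) hp) h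
    have hc : ((q - p : MvPolynomial M R) : MvPowerSeries M R) = q - p :=
      map_sub MvPolynomial.coeToMvPowerSeries.ringHom q p
    rwa [sub_sub_sub_cancel_left, ← hc] at this
  have := aeval_mem_ordGE hg hpq e (Nat.lt_succ_self _)
  rw [map_sub, map_sub] at this
  rw [map_sub]
  exact this

/-- Evaluation of completed polynomials at a family of power series without constant term. -/
def evalHom : CompletedPoly R M →+* MvPowerSeries κ R where
  toFun := evalFun g
  map_one' := by
    rw [← sub_eq_zero]
    refine eq_zero_of_forall_mem_ordGE fun n => ?_
    have := evalFun_sub_aeval_mem hg (f := 1) (p := 1) (n := n) (by simp)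
    simpa using this
  map_zero' := by
    refine eq_zero_of_forall_mem_ordGE fun n => ?_
    have := evalFun_sub_aeval_mem hg (f := 0) (p := 0) (n := n) (by simp)
    simpa using this
  map_add' f f' := by
    rw [← sub_eq_zero]
    refine eq_zero_of_forall_mem_ordGE fun n => ?_
    obtain ⟨p, hp⟩ := exists_poly_approx f.2 n
    obtain ⟨q, hq⟩ := exists_poly_approx f'.2 n
    have h := evalFun_sub_aeval_mem hg (f := f + f') (p := p + q) (n := n) (by
      have := add_mem hp hq
      convert this using 1
      push_cast
      ring)
    have := sub_mem h (add_mem (evalFun_sub_aeval_mem hg hp) (evalFun_sub_aeval_mem hg hq))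
    convert this using 1
    rw [map_add]
    ring
  map_mul' f f' := by
    rw [← sub_eq_zero]
    refine eq_zero_of_forall_mem_ordGE fun n => ?_
    obtain ⟨p, hp⟩ := exists_poly_approx f.2 n
    obtain ⟨q, hq⟩ := exists_poly_approx f'.2 n
    have h := evalFun_sub_aeval_mem hg (f := f * f') (p := p * q) (n := n) (by
      have := add_mem (Ideal.mul_mem_right (f' : MvPowerSeries M R) _ hp)
        (Ideal.mul_mem_left _ (p : MvPowerSeries M R) hq)
      convert this using 1
      push_cast
      ring)
    have := sub_mem h (add_mem (Ideal.mul_mem_right (evalFun g f') _ (evalFun_sub_aeval_mem hg hp))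
      (Ideal.mul_mem_left _ (MvPolynomial.aeval g p) (evalFun_sub_aeval_mem hg hq)))
    convert this using 1
    rw [map_mul]
    ring

theorem evalHom_sub_aeval_mem {f : CompletedPoly R M} {n : ℕ} {p : MvPolynomial M R}
    (hp : (f : MvPowerSeries M R) - p ∈ ordGE R M n) :
    evalHom hg f - MvPolynomial.aeval g p ∈ ordGE R κ n := evalFun_sub_aeval_mem hg hp

theorem evalHom_polyHom (p : MvPolynomial M R) :
    evalHom hg (polyHom R M p) = MvPolynomial.aeval g p := by
  rw [← sub_eq_zero]
  exact eq_zero_of_forall_mem_ordGE fun n => evalHom_sub_aeval_mem hg (by simp [coe_polyHom])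

theorem evalHom_var (μ : M) : evalHom hg (var R μ) = g μ := by
  rw [← polyHom_X, evalHom_polyHom, MvPolynomial.aeval_X]

theorem evalHom_mem {f : CompletedPoly R M} {n : ℕ} (hf : f ∈ orderIdeal R M n) :
    evalHom hg f ∈ ordGE R κ n := by
  have := evalHom_sub_aeval_mem hg (f := f) (p := 0) (n := n) (by simpa using mem_orderIdeal.1 hf)
  simpa using this

end Eval

theorem hasSubst_pair {f g : MvPowerSeries M R} (hf : f ∈ ordGE R M 1) (hg : g ∈ ordGE R M 1) :
    HasSubst ![f, g] :=
  hasSubst_of_constantCoeff_zero fun s => by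
    fin_cases s
    · exact mem_ordGE_one.1 hf
    · exact mem_ordGE_one.1 hg

theorem pair_mem {f g : MvPowerSeries M R} (hf : f ∈ ordGE R M 1) (hg : g ∈ ordGE R M 1)
    (s : Fin 2) : (![f, g] : Fin 2 → MvPowerSeries M R) s ∈ ordGE R M 1 := by
  fin_cases s
  · exact hf
  · exact hg

theorem X_mem_ordGE (μ : M) : (X μ : MvPowerSeries M R) ∈ ordGE R M 1 :=
  mem_ordGE_one.2 (constantCoeff_X μ)

theorem subst_sub_aeval_mem {a : Fin 2 → MvPowerSeries M R} (hs : HasSubst a)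
    (ha : ∀ s, a s ∈ ordGE R M 1) {G : MvPowerSeries (Fin 2) R} {p : MvPolynomial (Fin 2) R} {n : ℕ}
    (hp : G - (p : MvPowerSeries (Fin 2) R) ∈ ordGE R (Fin 2) n) :
    G.subst a - MvPolynomial.aeval a p ∈ ordGE R M n := by
  have := subst_mem_ordGE hs ha hp
  rwa [subst_sub hs, subst_coe] at this

/-- The element `G(x_μ, x_ν)` of `R[[x_M]]`. -/
def substVar (G : MvPowerSeries (Fin 2) R) (μ ν : M) : CompletedPoly R M :=
  ⟨G.subst ![X μ, X ν], subst_mem_completedPoly G μ ν⟩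

theorem formalSum_eq_substVar (F : FormalGroup R) (μ ν : M) :
    formalSum F μ ν = substVar F.toPowerSeries μ ν := rfl

theorem substVar_approx {G : MvPowerSeries (Fin 2) R} {p : MvPolynomial (Fin 2) R} {n : ℕ}
    (hp : G - (p : MvPowerSeries (Fin 2) R) ∈ ordGE R (Fin 2) n) (μ ν : M) :
    substVar G μ ν - polyHom R M (MvPolynomial.rename ![μ, ν] p) ∈ orderIdeal R M n := by
  have := subst_sub_aeval_mem (hasSubst_pair (X_mem_ordGE μ) (X_mem_ordGE ν))
    (pair_mem (X_mem_ordGE μ) (X_mem_ordGE ν)) hp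
  rw [mem_orderIdeal]
  convert this using 1
  change _ - (polyHom R M (MvPolynomial.rename ![μ, ν] p) : MvPowerSeries M R) = _
  congr 1
  change (((CompletedPoly R M).val.toRingHom.comp (polyHom R M)).comp
    (MvPolynomial.rename ![μ, ν]).toRingHom) p = (MvPolynomial.aeval ![X μ, X ν]).toRingHom p
  congr 1
  refine MvPolynomial.ringHom_ext (fun r => ?_) fun i => ?_
  · simp [coe_polyHom, MvPowerSeries.algebraMap_apply]
  · fin_cases i <;> simp [coe_polyHom]

/-- Both sides are approximated by the value of one and the same polynomial truncation of `G`. -/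
theorem evalHom_substVar {g : M → MvPowerSeries κ R} (hg : ∀ μ, g μ ∈ ordGE R κ 1)
    (G : MvPowerSeries (Fin 2) R) (μ ν : M) :
    evalHom hg (substVar G μ ν) = G.subst ![g μ, g ν] := by
  rw [← sub_eq_zero]
  refine eq_zero_of_forall_mem_ordGE fun n => ?_
  obtain ⟨p, hp⟩ := exists_poly_approx (mem_completedPoly_of_finite G) n
  have h1 := evalHom_mem hg (substVar_approx hp μ ν)
  rw [map_sub, evalHom_polyHom, MvPolynomial.aeval_rename] at h1
  have h2 := subst_sub_aeval_mem (hasSubst_pair (hg μ) (hg ν)) (pair_mem (hg μ) (hg ν)) hp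
  have h3 : g ∘ ![μ, ν] = ![g μ, g ν] := by
    ext1 i
    fin_cases i <;> rfl
  rw [h3] at h1
  have := sub_mem h1 h2
  rwa [sub_sub_sub_cancel_right] at this

/-- Ring homomorphisms that kill all series of order `≥ n` are determined by the images of
constants and variables. -/
theorem eq_of_var {B : Type*} [CommRing B] {φ ψ : CompletedPoly R M →+* B} {n : ℕ}
    (hφ : ∀ f ∈ orderIdeal R M n, φ f = 0) (hψ : ∀ f ∈ orderIdeal R M n, ψ f = 0)
    (hC : ∀ r : R, φ (algebraMap R _ r) = ψ (algebraMap R _ r))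
    (hX : ∀ μ, φ (var R μ) = ψ (var R μ)) : φ = ψ := by
  ext f
  obtain ⟨p, hp⟩ := exists_polyHom_approx f n
  have h1 := hφ _ hp
  have h2 := hψ _ hp
  rw [map_sub, sub_eq_zero] at h1 h2
  rw [h1, h2]
  change (φ.comp (polyHom R M)) p = (ψ.comp (polyHom R M)) p
  congr 1
  refine MvPolynomial.ringHom_ext (fun r => ?_) fun μ => ?_
  · have : polyHom R M (MvPolynomial.C r) = algebraMap R _ r :=
      Subtype.ext (MvPolynomial.coe_C r)
    simp [this, hC]
  · simp [polyHom_X, hX]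

/-- The image of `G(x_μ, x_ν)` depends on the images of the constants and of `x_μ`, `x_ν` only. -/
theorem map_substVar_congr {B : Type*} [CommRing B] {φ ψ : CompletedPoly R M →+* B} {n : ℕ}
    (hφ : ∀ f ∈ orderIdeal R M n, φ f = 0) (hψ : ∀ f ∈ orderIdeal R M n, ψ f = 0)
    (hC : ∀ r : R, φ (algebraMap R _ r) = ψ (algebraMap R _ r))
    (G : MvPowerSeries (Fin 2) R) {μ ν : M}
    (hμ : φ (var R μ) = ψ (var R μ)) (hν : φ (var R ν) = ψ (var R ν)) :
    φ (substVar G μ ν) = ψ (substVar G μ ν) := by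
  obtain ⟨p, hp⟩ := exists_poly_approx (mem_completedPoly_of_finite G) n
  have h := substVar_approx hp μ ν
  have h1 := hφ _ h
  have h2 := hψ _ h
  rw [map_sub, sub_eq_zero] at h1 h2
  rw [h1, h2]
  change ((φ.comp (polyHom R M)).comp (MvPolynomial.rename ![μ, ν]).toRingHom) p =
    ((ψ.comp (polyHom R M)).comp (MvPolynomial.rename ![μ, ν]).toRingHom) p
  congr 1
  refine MvPolynomial.ringHom_ext (fun r => ?_) fun i => ?_
  · have : polyHom R M (MvPolynomial.C r) = algebraMap R _ r :=
      Subtype.ext (MvPolynomial.coe_C r)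
    simp [this, hC]
  · fin_cases i
    · simp [polyHom_X, hμ]
    · simp [polyHom_X, hν]

end Evaluation

/-! ### The shape of a formal group law -/

section FormalGroupLaw

variable {R : Type*} [CommRing R] (F : FormalGroup R) {κ : Type*}

/-- The series `H` with `F = X + Y + X Y H`. -/
def crossTerm : MvPowerSeries (Fin 2) R := fun d =>
  coeff (Finsupp.single 0 1 + Finsupp.single 1 1 + d) F.toPowerSeries

theorem coeff_crossTerm (d : Fin 2 →₀ ℕ) : coeff d (crossTerm F) =
    coeff (Finsupp.single 0 1 + Finsupp.single 1 1 + d) F.toPowerSeries := rfl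

theorem coeff_subst_X_zero (G : MvPowerSeries (Fin 2) R) {d : Fin 2 →₀ ℕ} (hd : d 1 = 0) :
    coeff d (G.subst ![X (0 : Fin 2), (0 : MvPowerSeries (Fin 2) R)]) = coeff d G := by
  rw [coeff_subst (hasSubst_pair (X_mem_ordGE 0) (zero_mem _)), finsum_eq_single _ d]
  · rw [Finsupp.prod_fintype _ _ (by simp)]
    have : d = Finsupp.single 0 (d 0) := by
      ext i
      fin_cases i <;> simp [hd]
    simp only [Fin.prod_univ_two, hd, pow_zero, mul_one, Matrix.cons_val_zero]
    rw [coeff_X_pow, if_pos this]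
    simp
  · intro e he
    rw [Finsupp.prod_fintype _ _ (by simp)]
    simp only [Fin.prod_univ_two, Matrix.cons_val_zero, Matrix.cons_val_one]
    by_cases h1 : e 1 = 0
    · rw [h1, pow_zero, mul_one, coeff_X_pow, if_neg, smul_zero]
      rintro rfl
      apply he
      ext i
      fin_cases i <;> simp [h1]
    · simp [h1]

theorem coeff_subst_zero_X (G : MvPowerSeries (Fin 2) R) {d : Fin 2 →₀ ℕ} (hd : d 0 = 0) :
    coeff d (G.subst ![(0 : MvPowerSeries (Fin 2) R), X (1 : Fin 2)]) = coeff d G := by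
  rw [coeff_subst (hasSubst_pair (zero_mem _) (X_mem_ordGE 1)), finsum_eq_single _ d]
  · rw [Finsupp.prod_fintype _ _ (by simp)]
    have : d = Finsupp.single 1 (d 1) := by
      ext i
      fin_cases i <;> simp [hd]
    simp only [Fin.prod_univ_two, hd, pow_zero, one_mul, Matrix.cons_val_one, Matrix.cons_val_fin_one]
    rw [coeff_X_pow, if_pos this]
    simp
  · intro e he
    rw [Finsupp.prod_fintype _ _ (by simp)]
    simp only [Fin.prod_univ_two, Matrix.cons_val_zero, Matrix.cons_val_one]
    by_cases h1 : e 0 = 0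
    · rw [h1, pow_zero, one_mul, coeff_X_pow, if_neg, smul_zero]
      rintro rfl
      apply he
      ext i
      fin_cases i <;> simp [h1]
    · simp [h1]

/-- The unit laws `F(X,0) = X` and `F(0,Y) = Y` fix all coefficients on the two axes; every other
monomial is divisible by `XY` and belongs to the cross term by construction. -/
theorem eq_X_add_X_add_crossTerm :
    F.toPowerSeries = X 0 + X 1 + X 0 * X 1 * crossTerm F := by
  ext d
  have hX0 : PowerSeries.HasSubst (X (0 : Fin 2) : MvPowerSeries (Fin 2) R) := by
    simp [PowerSeries.HasSubst]
  have hX1 : PowerSeries.HasSubst (X (1 : Fin 2) : MvPowerSeries (Fin 2) R) := by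
    simp [PowerSeries.HasSubst]
  by_cases h1 : d 1 = 0
  · rw [← coeff_subst_X_zero _ h1, F.add_zero hX0, add_assoc, map_add, left_eq_add]
    have h : (X 1 : MvPowerSeries (Fin 2) R) ∣ X 1 + X 0 * X 1 * crossTerm F :=
      Dvd.intro (1 + X 0 * crossTerm F) (by ring)
    exact X_dvd_iff.1 h d h1
  by_cases h0 : d 0 = 0
  · rw [← coeff_subst_zero_X _ h0, F.zero_add hX1, add_comm (X 0), add_assoc, map_add, left_eq_add]
    have h : (X 0 : MvPowerSeries (Fin 2) R) ∣ X 0 + X 0 * X 1 * crossTerm F :=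
      Dvd.intro (1 + X 1 * crossTerm F) (by ring)
    exact X_dvd_iff.1 h d h0
  obtain ⟨c, rfl⟩ : ∃ c, d = Finsupp.single 0 1 + Finsupp.single 1 1 + c := by
    refine ⟨d - (Finsupp.single 0 1 + Finsupp.single 1 1), ?_⟩
    ext i
    fin_cases i
    · simp; omega
    · simp; omega
  have hX : (X 0 * X 1 : MvPowerSeries (Fin 2) R) =
      monomial (Finsupp.single 0 1 + Finsupp.single 1 1) 1 := by
    rw [X, X, monomial_mul_monomial, one_mul]
  rw [hX, map_add, coeff_add_monomial_mul, one_mul, coeff_crossTerm, right_eq_add, map_add,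
    coeff_X, coeff_X, if_neg, if_neg, add_zero]
  · intro h
    have := DFunLike.congr_fun h 0
    simp at this
  · intro h
    have := DFunLike.congr_fun h 1
    simp at this

theorem subst_formalGroup {f g : MvPowerSeries κ R} (hf : f ∈ ordGE R κ 1)
    (hg : g ∈ ordGE R κ 1) :
    F.toPowerSeries.subst ![f, g] = f + g + f * g * (crossTerm F).subst ![f, g] := by
  have hs := hasSubst_pair hf hg
  conv_lhs => rw [eq_X_add_X_add_crossTerm F]
  rw [subst_add hs, subst_add hs, subst_mul hs, subst_mul hs, subst_X hs, subst_X hs]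
  rfl

theorem subst_congr_ordGE (G : MvPowerSeries (Fin 2) R) {f g f' g' : MvPowerSeries κ R}
    (hf : f ∈ ordGE R κ 1) (hg : g ∈ ordGE R κ 1) (hf' : f' ∈ ordGE R κ 1)
    (hg' : g' ∈ ordGE R κ 1) {n : ℕ} (h1 : f - f' ∈ ordGE R κ n) (h2 : g - g' ∈ ordGE R κ n) :
    G.subst ![f, g] - G.subst ![f', g'] ∈ ordGE R κ n := by
  obtain ⟨p, hp⟩ := exists_poly_approx (mem_completedPoly_of_finite G) n
  have e1 := subst_sub_aeval_mem (hasSubst_pair hf hg) (pair_mem hf hg) hp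
  have e2 := subst_sub_aeval_mem (hasSubst_pair hf' hg') (pair_mem hf' hg') hp
  rw [← Ideal.Quotient.eq] at e1 e2 h1 h2 ⊢
  rw [e1, e2]
  change ((Ideal.Quotient.mk (ordGE R κ n)).comp (MvPolynomial.aeval ![f, g]).toRingHom) p =
    ((Ideal.Quotient.mk (ordGE R κ n)).comp (MvPolynomial.aeval ![f', g']).toRingHom) p
  congr 1
  refine MvPolynomial.ringHom_ext (fun r => by simp) fun i => ?_
  fin_cases i
  · simpa using h1
  · simpa using h2

end FormalGroupLaw

/-! ### The group of points with values in power series -/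

section Points

variable {R : Type*} [CommRing R] [IsDomain R] (F : FormalGroup R) {κ : Type*}

theorem hasSubst_iff_mem_ordGE {f : MvPowerSeries κ R} :
    PowerSeries.HasSubst f ↔ f ∈ ordGE R κ 1 := by
  rw [mem_ordGE_one, PowerSeries.HasSubst, isNilpotent_iff_eq_zero]

variable {F} in
theorem point_mem (x : F.Point κ) : x.val ∈ ordGE R κ 1 := hasSubst_iff_mem_ordGE.1 x.2

/-- The point of the formal group given by a series without constant term. -/
def toPoint {f : MvPowerSeries κ R} (hf : f ∈ ordGE R κ 1) : F.Point κ :=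
  ⟨f, hasSubst_iff_mem_ordGE.2 hf⟩

theorem point_add_val (x y : F.Point κ) :
    (x + y).val = x.val + y.val + x.val * y.val * (crossTerm F).subst ![x.val, y.val] :=
  subst_formalGroup F (point_mem x) (point_mem y)

/-- Successive approximations to the inverse of `x` in the formal group. -/
def approxNeg (x : F.Point κ) : ℕ → F.Point κ
  | 0 => 0
  | n + 1 => approxNeg x n + toPoint F (neg_mem (point_mem (x + approxNeg x n)))

/-- If `r` is the current error, correcting by `-r` replaces it by `r - r - r²H`, whose order is at
least twice that of `r`, hence larger by at least one. -/
theorem approxNeg_mem (x : F.Point κ) (n : ℕ) :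
    (x + approxNeg F x n).val ∈ ordGE R κ (n + 1) := by
  induction n with
  | zero => exact point_mem _
  | succ n ih =>
    rw [approxNeg, ← add_assoc, point_add_val]
    simp only [toPoint, add_neg_cancel, zero_add]
    refine Ideal.mul_mem_right _ _ (ordGE_anti (by omega) (mul_mem_ordGE ih (neg_mem ih)))

theorem approxNeg_sub_mem (x : F.Point κ) (n : ℕ) :
    (approxNeg F x (n + 1)).val - (approxNeg F x n).val ∈ ordGE R κ (n - 0) := by
  have h := ordGE_anti (by omega : n - 0 ≤ n + 1) (approxNeg_mem F x n)
  rw [approxNeg, point_add_val]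
  simp only [toPoint]
  rw [add_assoc, add_sub_cancel_left]
  exact add_mem (neg_mem h) (Ideal.mul_mem_right _ _ (Ideal.mul_mem_left _ _ (neg_mem h)))

theorem exists_add_eq_zero (x : F.Point κ) : ∃ y, x + y = 0 := by
  obtain ⟨w, hw⟩ := exists_limit_ordGE (fun n => (approxNeg F x n).val) (approxNeg_sub_mem F x)
  have hw1 : w ∈ ordGE R κ 1 := by
    have := add_mem (hw 1) (point_mem (approxNeg F x 1))
    rwa [sub_add_cancel] at this
  refine ⟨toPoint F hw1, Subtype.ext (eq_zero_of_forall_mem_ordGE fun n => ?_)⟩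
  have h1 := subst_congr_ordGE F.toPowerSeries (n := n) (point_mem x) hw1 (point_mem x)
    (point_mem (approxNeg F x n)) (by simp) (hw n)
  have h2 := ordGE_anti (by omega : n ≤ n + 1) (approxNeg_mem F x n)
  have := add_mem h1 h2
  rwa [FormalGroup.add_apply, sub_add_cancel] at this

variable [F.IsComm]

instance : Neg (F.Point κ) := ⟨fun x => (exists_add_eq_zero F x).choose⟩

/-- Being a `ℤ`-module, the group of points receives a homomorphism from a free lattice with
arbitrary values on a basis. -/
instance pointAddCommGroup : AddCommGroup (F.Point κ) where
  zsmul := zsmulRec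
  neg_add_cancel x := by
    rw [add_comm]
    exact (exists_add_eq_zero F x).choose_spec
  add_comm := add_comm

/-- The linear coefficients of a point, as a homomorphism to the additive group. -/
def linCoeff (i : κ) : F.Point κ →+ R where
  toFun x := coeff (Finsupp.single i 1) x.val
  map_zero' := by simp
  map_add' x y := by
    rw [point_add_val, map_add, map_add, add_eq_left]
    -- The cross term has order at least 2 and does not meet the linear coefficients.
    exact Ideal.mul_mem_right _ _ (mul_mem_ordGE (point_mem x) (point_mem y)) _
      (by simp [Finsupp.degree_single])

variable {M : Type*} [AddCommGroup M] (b : Module.Basis κ ℤ M)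

/-- The homomorphism from a lattice to the formal group that sends basis vectors to variables. -/
def pointHom : M →+ F.Point κ :=
  (b.constr ℤ fun i => toPoint F (X_mem_ordGE i)).toAddMonoidHom

theorem pointHom_basis (i : κ) : (pointHom F b (b i)).val = X i := by
  have : pointHom F b (b i) = toPoint F (X_mem_ordGE i) := b.constr_basis ℤ _ i
  rw [this]
  rfl

/-- The linear part of the series attached to `μ` consists of the coordinates of `μ`. In
characteristic 0 it therefore determines `μ`. -/
theorem coeff_pointHom (μ : M) (i : κ) :
    coeff (Finsupp.single i 1) (pointHom F b μ).val = (b.repr μ i : R) := by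
  classical
  have : ((linCoeff F i).comp (pointHom F b)).toIntLinearMap =
      (Int.castAddHom R).toIntLinearMap.comp (b.coord i) := by
    refine b.ext fun j => ?_
    change coeff (Finsupp.single i 1) (pointHom F b (b j)).val = ((b.repr (b j) i : ℤ) : R)
    rw [pointHom_basis, coeff_X, b.repr_self, Finsupp.single_apply]
    simp [Finsupp.single_left_inj, eq_comm]
  exact DFunLike.congr_fun this μ

end Points

/-! ### The order filtration on the formal group algebra -/

section Filtration

variable {R : Type*} [CommRing R] (F : FormalGroup R) (M : Type*) [AddCommGroup M]

/-- The filtration of the formal group algebra by order. -/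
def fgFilt (n : ℕ) : Ideal (FGAlg F M) := (orderIdeal R M n).map (fgMk F M)

variable {F M}

theorem mem_fgFilt {n : ℕ} {s : FGAlg F M} :
    s ∈ fgFilt F M n ↔ ∃ f ∈ orderIdeal R M n, fgMk F M f = s :=
  Ideal.mem_map_iff_of_surjective _ (fgMk_surjective F M)

theorem fgMk_mem_fgFilt {n : ℕ} {f : CompletedPoly R M} (hf : f ∈ orderIdeal R M n) :
    fgMk F M f ∈ fgFilt F M n := Ideal.mem_map_of_mem _ hf

theorem mem_fgFilt_zero (s : FGAlg F M) : s ∈ fgFilt F M 0 := by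
  obtain ⟨f, rfl⟩ := fgMk_surjective F M s
  exact fgMk_mem_fgFilt fun e he => by omega

theorem mul_mem_fgFilt {m n : ℕ} {s t : FGAlg F M} (hs : s ∈ fgFilt F M m)
    (ht : t ∈ fgFilt F M n) : s * t ∈ fgFilt F M (m + n) := by
  obtain ⟨f, hf, rfl⟩ := mem_fgFilt.1 hs
  obtain ⟨g, hg, rfl⟩ := mem_fgFilt.1 ht
  rw [← map_mul]
  exact fgMk_mem_fgFilt (mem_orderIdeal.2 (mul_mem_ordGE hf hg))

/-- The filtration is separated precisely because the quotient is by the closure of the ideal of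
relations. -/
theorem eq_zero_of_forall_mem_fgFilt {s : FGAlg F M} (h : ∀ n, s ∈ fgFilt F M n) : s = 0 := by
  obtain ⟨f, rfl⟩ := fgMk_surjective F M s
  refine Ideal.Quotient.eq_zero_iff_mem.2 ?_
  rw [closedRelIdeal, Ideal.mem_iInf]
  intro n
  obtain ⟨g, hg, hgf⟩ := mem_fgFilt.1 (h n)
  have h1 : f - g ∈ closedRelIdeal F M := Ideal.Quotient.eq.1 hgf.symm
  rw [closedRelIdeal, Ideal.mem_iInf] at h1
  have := add_mem (h1 n) (Submodule.mem_sup_right hg)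
  rwa [sub_add_cancel] at this

theorem xElt_mem_fgFilt_one (μ : M) : xElt F μ ∈ fgFilt F M 1 :=
  fgMk_mem_fgFilt (mem_orderIdeal.2 (X_mem_ordGE μ))

theorem relIdeal_le_closedRelIdeal : relIdeal F M ≤ closedRelIdeal F M :=
  le_iInf fun _ => le_sup_left

theorem xElt_zero : xElt F (0 : M) = 0 :=
  Ideal.Quotient.eq_zero_iff_mem.2 (relIdeal_le_closedRelIdeal (Ideal.subset_span (Or.inl rfl)))

theorem xElt_add_eq_formalSum (μ ν : M) : xElt F (μ + ν) = fgMk F M (formalSum F μ ν) :=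
  Ideal.Quotient.eq.2
    (relIdeal_le_closedRelIdeal (Ideal.subset_span (Or.inr ⟨μ, ν, rfl⟩)))

/-- The element `h` with `x_{μ+ν} = x_μ + x_ν + x_μ x_ν h`. -/
def hElt (F : FormalGroup R) (μ ν : M) : FGAlg F M := fgMk F M (substVar (crossTerm F) μ ν)

theorem xElt_add (μ ν : M) :
    xElt F (μ + ν) = xElt F μ + xElt F ν + xElt F μ * xElt F ν * hElt F μ ν := by
  rw [xElt_add_eq_formalSum]
  have : formalSum F μ ν = var R μ + var R ν + var R μ * var R ν * substVar (crossTerm F) μ ν :=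
    Subtype.ext (subst_formalGroup F (X_mem_ordGE μ) (X_mem_ordGE ν))
  rw [this, map_add, map_add, map_mul, map_mul]
  rfl

end Filtration

/-! ### Identification of the formal group algebra with a power series ring -/

section Rename

variable {R : Type*} [CommRing R] {M κ : Type*} [Finite κ]

theorem rename_mem_ordGE {f : MvPowerSeries κ R} {n : ℕ} (hf : f ∈ ordGE R κ n) (v : κ → M) :
    rename v f ∈ ordGE R M n := by
  intro e he
  rw [coeff_rename]
  refine Finset.sum_eq_zero fun d hd => hf d ?_
  have hd' : d.mapDomain v = e := by simpa using hd
  rwa [← hd', Finsupp.degree_mapDomain] at he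

theorem rename_mem_completedPoly' (f : MvPowerSeries κ R) (v : κ → M) :
    rename v f ∈ CompletedPoly R M := by
  intro n
  refine ((Finsupp.finite_of_degree_le n).image (Finsupp.mapDomain v)).subset ?_
  rintro e ⟨hd, he⟩
  by_contra hne
  refine he (coeff_rename_eq_zero v f ?_)
  rintro ⟨d, rfl⟩
  rw [Finsupp.degree_mapDomain] at hd
  exact hne ⟨d, hd, rfl⟩

/-- Power series in finitely many of the variables `x_μ`. -/
def renameHom (R : Type*) [CommRing R] (v : κ → M) : MvPowerSeries κ R →+* CompletedPoly R M :=
  (rename v : MvPowerSeries κ R →ₐ[R] MvPowerSeries M R).toRingHom.codRestrict (CompletedPoly R M)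
    fun f => rename_mem_completedPoly' f v

end Rename

section OfSeries

variable {R : Type*} [CommRing R] (F : FormalGroup R)
variable {M κ : Type*} [AddCommGroup M] (b : Module.Basis κ ℤ M) [Finite κ]

/-- The homomorphism from power series to the formal group algebra given by a basis. -/
def ofSeries : MvPowerSeries κ R →+* FGAlg F M := (fgMk F M).comp (renameHom R b)

theorem ofSeries_mem {f : MvPowerSeries κ R} {n : ℕ} (hf : f ∈ ordGE R κ n) :
    ofSeries F b f ∈ fgFilt F M n :=
  fgMk_mem_fgFilt (mem_orderIdeal.2 (rename_mem_ordGE hf b))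

theorem ofSeries_X (i : κ) : ofSeries F b (X i) = xElt F (b i) :=
  congrArg (fgMk F M) (Subtype.ext (rename_X (R := R) b i))

end OfSeries

section Iso

variable {R : Type*} [CommRing R] [IsDomain R] (F : FormalGroup R) [F.IsComm]
variable {M κ : Type*} [AddCommGroup M] (b : Module.Basis κ ℤ M)

theorem pointHom_mem (μ : M) : (pointHom F b μ).val ∈ ordGE R κ 1 := point_mem _

/-- Evaluation of completed polynomials at `x_μ = F`-linear combination of variables. -/
def preSeries : CompletedPoly R M →+* MvPowerSeries κ R := evalHom (pointHom_mem F b)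

theorem preSeries_mem {f : CompletedPoly R M} {n : ℕ} (hf : f ∈ orderIdeal R M n) :
    preSeries F b f ∈ ordGE R κ n := evalHom_mem _ hf

/-- The generators of the ideal say that `μ ↦ x_μ` is additive for the formal group law, and
`pointHom` is such a homomorphism. -/
theorem preSeries_relIdeal {f : CompletedPoly R M} (hf : f ∈ relIdeal F M) :
    preSeries F b f = 0 := by
  have : relIdeal F M ≤ RingHom.ker (preSeries F b) := by
    refine Ideal.span_le.2 ?_
    rintro z (rfl | ⟨μ, ν, rfl⟩)
    · change preSeries F b (var R 0) = 0
      rw [preSeries, evalHom_var, map_zero]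
      rfl
    · change preSeries F b (var R (μ + ν) - formalSum F μ ν) = 0
      rw [map_sub, sub_eq_zero, preSeries, evalHom_var, formalSum_eq_substVar, evalHom_substVar,
        map_add, FormalGroup.add_apply]
  exact this hf

theorem preSeries_closedRelIdeal {f : CompletedPoly R M} (hf : f ∈ closedRelIdeal F M) :
    preSeries F b f = 0 := by
  refine eq_zero_of_forall_mem_ordGE fun n => ?_
  rw [closedRelIdeal, Ideal.mem_iInf] at hf
  obtain ⟨g, hg, h, hh, rfl⟩ := Submodule.mem_sup.1 (hf n)
  rw [map_add, preSeries_relIdeal F b hg, zero_add]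
  exact preSeries_mem F b hh

/-- The homomorphism from the formal group algebra to power series given by a basis. -/
def toSeries : FGAlg F M →+* MvPowerSeries κ R :=
  Ideal.Quotient.lift (closedRelIdeal F M) (preSeries F b)
    fun _ hf => preSeries_closedRelIdeal F b hf

theorem toSeries_mk (f : CompletedPoly R M) : toSeries F b (fgMk F M f) = preSeries F b f := rfl

theorem toSeries_xElt (μ : M) : toSeries F b (xElt F μ) = (pointHom F b μ).val :=
  evalHom_var (pointHom_mem F b) μ

theorem toSeries_mem {s : FGAlg F M} {n : ℕ} (hs : s ∈ fgFilt F M n) :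
    toSeries F b s ∈ ordGE R κ n := by
  obtain ⟨f, hf, rfl⟩ := mem_fgFilt.1 hs
  exact preSeries_mem F b hf

variable [Finite κ]

theorem toSeries_ofSeries (f : MvPowerSeries κ R) : toSeries F b (ofSeries F b f) = f := by
  rw [← sub_eq_zero]
  refine eq_zero_of_forall_mem_ordGE fun n => ?_
  obtain ⟨p, hp⟩ := exists_poly_approx (mem_completedPoly_of_finite f) n
  have h1 : (renameHom R b f : MvPowerSeries M R) - (MvPolynomial.rename b p : MvPolynomial M R) ∈
      ordGE R M n := by
    have := rename_mem_ordGE hp b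
    rwa [map_sub, rename_coe] at this
  have h2 := evalHom_sub_aeval_mem (pointHom_mem F b) h1
  have h3 : MvPolynomial.aeval (fun μ => (pointHom F b μ).val) (MvPolynomial.rename b p) =
      (p : MvPowerSeries κ R) := by
    rw [MvPolynomial.aeval_rename]
    change (MvPolynomial.aeval ((fun μ => (pointHom F b μ).val) ∘ b)).toRingHom p =
      MvPolynomial.coeToMvPowerSeries.ringHom p
    congr 1
    refine MvPolynomial.ringHom_ext (fun r => by simp [MvPowerSeries.algebraMap_apply]) fun i => ?_
    simp [pointHom_basis]
  rw [h3] at h2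
  have := sub_mem h2 hp
  rwa [sub_sub_sub_cancel_right] at this

/-- The composite of `toSeries` and `ofSeries`. -/
def roundTrip : FGAlg F M →+* FGAlg F M := (ofSeries F b).comp (toSeries F b)

theorem roundTrip_mem {s : FGAlg F M} {n : ℕ} (hs : s ∈ fgFilt F M n) :
    roundTrip F b s ∈ fgFilt F M n := ofSeries_mem F b (toSeries_mem F b hs)

theorem roundTrip_algebraMap (r : R) :
    roundTrip F b (fgMk F M (algebraMap R _ r)) = fgMk F M (algebraMap R _ r) := by
  have h : algebraMap R (CompletedPoly R M) r = polyHom R M (MvPolynomial.C r) :=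
    Subtype.ext (MvPolynomial.coe_C r).symm
  have h1 : toSeries F b (fgMk F M (algebraMap R _ r)) = C r := by
    rw [h, toSeries_mk, preSeries, evalHom_polyHom]
    simp [MvPowerSeries.algebraMap_apply]
  change ofSeries F b (toSeries F b _) = _
  rw [h1]
  exact congrArg (fgMk F M) (Subtype.ext (rename_C (R := R) b r))

theorem roundTrip_substVar_sub_mem (G : MvPowerSeries (Fin 2) R) {μ ν : M} {n : ℕ}
    (hμ : roundTrip F b (xElt F μ) - xElt F μ ∈ fgFilt F M n)
    (hν : roundTrip F b (xElt F ν) - xElt F ν ∈ fgFilt F M n) :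
    roundTrip F b (fgMk F M (substVar G μ ν)) - fgMk F M (substVar G μ ν) ∈ fgFilt F M n := by
  rw [← Ideal.Quotient.eq] at hμ hν ⊢
  refine map_substVar_congr
    (φ := (Ideal.Quotient.mk (fgFilt F M n)).comp ((roundTrip F b).comp (fgMk F M)))
    (ψ := (Ideal.Quotient.mk (fgFilt F M n)).comp (fgMk F M)) (n := n) ?_ ?_ ?_ G hμ hν
  · intro f hf
    exact Ideal.Quotient.eq_zero_iff_mem.2 (roundTrip_mem F b (fgMk_mem_fgFilt hf))
  · intro f hf
    exact Ideal.Quotient.eq_zero_iff_mem.2 (fgMk_mem_fgFilt hf)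
  · intro r
    exact congrArg _ (roundTrip_algebraMap F b r)

/-- The relation `0 = x_μ + x_{-μ} + x_μ x_{-μ} h` determines `x_{-μ}` only implicitly, since `h`
involves `x_{-μ}` too. But it expresses the discrepancy as `x_μ` times terms of the same order, so
the order of the discrepancy rises by one at each step of the induction. -/
theorem roundTrip_xElt_neg {μ : M} (h : roundTrip F b (xElt F μ) = xElt F μ) :
    roundTrip F b (xElt F (-μ)) = xElt F (-μ) := by
  rw [← sub_eq_zero]
  refine eq_zero_of_forall_mem_fgFilt fun n => ?_
  induction n with
  | zero => exact mem_fgFilt_zero _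
  | succ n ih =>
    have hh := roundTrip_substVar_sub_mem F b (crossTerm F) (μ := μ) (by simp [h]) ih
    have e1 : 0 = xElt F μ + xElt F (-μ) + xElt F μ * xElt F (-μ) * hElt F μ (-μ) := by
      rw [← xElt_add, add_neg_cancel, xElt_zero]
    have e2 := congrArg (roundTrip F b) e1
    simp only [map_zero, map_add, map_mul, h] at e2
    have key : roundTrip F b (xElt F (-μ)) - xElt F (-μ) =
        xElt F μ * (-((roundTrip F b (xElt F (-μ)) - xElt F (-μ)) * hElt F μ (-μ)) -
        roundTrip F b (xElt F (-μ)) * (roundTrip F b (hElt F μ (-μ)) - hElt F μ (-μ))) := by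
      linear_combination e1 - e2
    rw [key, add_comm]
    exact mul_mem_fgFilt (xElt_mem_fgFilt_one μ)
      (sub_mem (neg_mem (Ideal.mul_mem_right _ _ ih)) (Ideal.mul_mem_left _ _ hh))

/-- The `μ` for which this holds form a subgroup containing the basis. -/
theorem roundTrip_xElt (μ : M) : roundTrip F b (xElt F μ) = xElt F μ := by
  let A : AddSubgroup M :=
    { carrier := {μ | roundTrip F b (xElt F μ) = xElt F μ}
      zero_mem' := by
        change roundTrip F b (xElt F 0) = xElt F 0
        rw [xElt_zero, map_zero]
      add_mem' := by
        intro μ ν hμ hν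
        change roundTrip F b (xElt F (μ + ν)) = xElt F (μ + ν)
        rw [← sub_eq_zero, xElt_add_eq_formalSum]
        refine eq_zero_of_forall_mem_fgFilt fun n => ?_
        exact roundTrip_substVar_sub_mem F b _ (sub_eq_zero.2 hμ ▸ zero_mem _)
          (sub_eq_zero.2 hν ▸ zero_mem _)
      neg_mem' := fun h => roundTrip_xElt_neg F b h }
  have hle : Submodule.span ℤ (Set.range b) ≤ AddSubgroup.toIntSubmodule A := by
    refine Submodule.span_le.2 ?_
    rintro _ ⟨i, rfl⟩
    change roundTrip F b (xElt F (b i)) = xElt F (b i)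
    rw [roundTrip, RingHom.comp_apply, toSeries_xElt, pointHom_basis, ofSeries_X]
  exact hle (b.mem_span μ)

theorem ofSeries_toSeries (s : FGAlg F M) : ofSeries F b (toSeries F b s) = s := by
  change roundTrip F b s = s
  rw [← sub_eq_zero]
  refine eq_zero_of_forall_mem_fgFilt fun n => ?_
  rw [← Ideal.Quotient.eq]
  obtain ⟨f, rfl⟩ := fgMk_surjective F M s
  have := eq_of_var
    (φ := (Ideal.Quotient.mk (fgFilt F M n)).comp ((roundTrip F b).comp (fgMk F M)))
    (ψ := (Ideal.Quotient.mk (fgFilt F M n)).comp (fgMk F M)) (n := n)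
    (fun f hf => Ideal.Quotient.eq_zero_iff_mem.2 (roundTrip_mem F b (fgMk_mem_fgFilt hf)))
    (fun f hf => Ideal.Quotient.eq_zero_iff_mem.2 (fgMk_mem_fgFilt hf))
    (fun r => congrArg _ (roundTrip_algebraMap F b r))
    (fun μ => congrArg _ (roundTrip_xElt F b μ))
  exact DFunLike.congr_fun this f

/-- A basis of the lattice identifies the formal group algebra with a power series ring. -/
def fgEquiv : FGAlg F M ≃+* MvPowerSeries κ R :=
  RingEquiv.ofRingHom (toSeries F b) (ofSeries F b)
    (RingHom.ext (toSeries_ofSeries F b)) (RingHom.ext (ofSeries_toSeries F b))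

theorem fgEquiv_xElt (μ : M) : fgEquiv F b (xElt F μ) = (pointHom F b μ).val := toSeries_xElt F b μ

theorem fgEquiv_mem {s : FGAlg F M} {n : ℕ} (hs : s ∈ fgFilt F M n) :
    fgEquiv F b s ∈ ordGE R κ n := toSeries_mem F b hs

end Iso

/-! ### Primes and closed principal ideals in power series rings -/

theorem mem_ordGE_iff_le_order {R : Type*} [CommRing R] {σ : Type*} {n : ℕ} {f : MvPowerSeries σ R} :
    f ∈ ordGE R σ n ↔ (n : ℕ∞) ≤ f.order := by
  constructor
  · exact nat_le_order
  · intro h e he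
    exact coeff_of_lt_order (lt_of_lt_of_le (by exact_mod_cast he) h)

section PowerSeriesDomain

variable {R : Type*} [CommRing R] [IsDomain R] {σ : Type*}

theorem prime_X (s : σ) : Prime (X s : MvPowerSeries σ R) := by
  classical
  -- With weight 1 on `s` and 0 elsewhere, positive weighted order means divisibility by the
  -- variable, and weighted order is additive on products over a domain.
  let w : σ → ℕ := Pi.single s 1
  have hw : ∀ d : σ →₀ ℕ, Finsupp.weight w d = d s := by
    intro d
    rw [Finsupp.weight_apply, Finsupp.sum, Finset.sum_eq_single s]
    · simp [w]
    · intro t _ ht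
      simp [w, ht]
    · intro hs
      simp [Finsupp.notMem_support_iff.1 hs]
  have key : ∀ f : MvPowerSeries σ R, X s ∣ f ↔ (1 : ℕ) ≤ f.weightedOrder w := by
    intro f
    rw [X_dvd_iff]
    constructor
    · intro h
      refine nat_le_weightedOrder w fun d hd => h d ?_
      rw [hw] at hd
      omega
    · intro h d hd
      refine coeff_eq_zero_of_lt_weightedOrder w (lt_of_lt_of_le ?_ h)
      rw [hw, hd]
      norm_num
  refine ⟨fun h => ?_, fun h => ?_, fun f g h => ?_⟩
  · have := congrArg (coeff (Finsupp.single s 1)) h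
    simp at this
  · have := X_dvd_iff.1 (h.dvd : (X s : MvPowerSeries σ R) ∣ 1) 0 rfl
    simp at this
  · rw [key, weightedOrder_mul] at h
    rw [key, key]
    by_contra hcon
    rw [not_or, not_le, not_le] at hcon
    have h1 : f.weightedOrder w = 0 := by simpa [Order.lt_one_iff] using hcon.1
    have h2 : g.weightedOrder w = 0 := by simpa [Order.lt_one_iff] using hcon.2
    rw [h1, h2] at h
    norm_num at h

/-- Principal ideals generated by series of order one are closed. -/
theorem dvd_of_forall_ordGE {y z : MvPowerSeries σ R} {i : σ} (hi : coeff (Finsupp.single i 1) y ≠ 0)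
    (h : ∀ n, ∃ v, z - y * v ∈ ordGE R σ n) : y ∣ z := by
  have hy : y.order ≤ 1 := by
    have := order_le hi
    simpa [Finsupp.degree_single] using this
  -- Cancelling `y`, of order at most 1, costs at most one degree; hence the limit below is taken
  -- with a loss of `k = 1`.
  have hcancel : ∀ {v : MvPowerSeries σ R} {n : ℕ}, y * v ∈ ordGE R σ n → v ∈ ordGE R σ (n - 1) := by
    intro v n hv
    rw [mem_ordGE_iff_le_order, order_mul] at hv
    rw [mem_ordGE_iff_le_order]
    have := hv.trans (add_le_add_left hy _)
    rw [add_comm] at this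
    simpa [tsub_le_iff_right] using this
  choose v hv using h
  have hstep : ∀ n, v (n + 1) - v n ∈ ordGE R σ (n - 1) := by
    intro n
    refine hcancel ?_
    have := sub_mem (hv n) (ordGE_anti (Nat.le_succ n) (hv (n + 1)))
    convert this using 1
    ring
  obtain ⟨w, hw⟩ := exists_limit_ordGE v hstep
  refine ⟨w, ?_⟩
  rw [← sub_eq_zero]
  refine eq_zero_of_forall_mem_ordGE fun n => ?_
  have := sub_mem (ordGE_anti (Nat.le_succ n) (hv (n + 1)))
    (Ideal.mul_mem_left _ y (hw (n + 1)))
  convert this using 1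
  ring

end PowerSeriesDomain

/-! ### Divisibility among the elements `x_μ` -/

section Divisibility

variable {R : Type*} [CommRing R] (F : FormalGroup R) {M : Type*} [AddCommGroup M]

theorem xElt_dvd_add_sub (μ ν : M) : xElt F ν ∣ xElt F (μ + ν) - xElt F μ :=
  ⟨1 + xElt F μ * hElt F μ ν, by rw [xElt_add]; ring⟩

theorem xElt_neg_relation (μ : M) :
    xElt F μ = -xElt F (-μ) * (1 + xElt F μ * hElt F μ (-μ)) := by
  have h := xElt_add (F := F) μ (-μ)
  rw [add_neg_cancel, xElt_zero] at h
  linear_combination -h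

theorem xElt_neg_dvd (μ : M) : xElt F (-μ) ∣ xElt F μ :=
  ⟨-(1 + xElt F μ * hElt F μ (-μ)), by linear_combination xElt_neg_relation F μ⟩

theorem xElt_dvd_neg (μ : M) : xElt F μ ∣ xElt F (-μ) := by
  simpa using xElt_neg_dvd F (-μ)

theorem xElt_dvd_zsmul (a : M) (k : ℤ) : xElt F a ∣ xElt F (k • a) := by
  have hnat : ∀ n : ℕ, xElt F a ∣ xElt F (n • a) := by
    intro n
    induction n with
    | zero => simp [xElt_zero]
    | succ n ih =>
      rw [succ_nsmul]
      have := dvd_add (xElt_dvd_add_sub F (n • a) a) ih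
      rwa [sub_add_cancel] at this
  obtain ⟨n, rfl | rfl⟩ := k.eq_nat_or_neg
  · simpa using hnat n
  · rw [neg_smul]
    exact (by simpa using hnat n : xElt F a ∣ xElt F ((n : ℤ) • a)).trans (xElt_dvd_neg F _)

theorem xElt_dvd_sub_zsmul (μ a : M) (k : ℤ) : xElt F a ∣ xElt F (μ + k • a) - xElt F μ :=
  (xElt_dvd_zsmul F a k).trans (xElt_dvd_add_sub F μ _)

theorem latticeHom_mem (σ : M ≃+ M) {s : FGAlg F M} {n : ℕ} (hs : s ∈ fgFilt F M n) :
    latticeHom F σ s ∈ fgFilt F M n := by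
  obtain ⟨f, hf, rfl⟩ := mem_fgFilt.1 hs
  rw [latticeHom_mk]
  refine fgMk_mem_fgFilt fun e he => ?_
  rw [coe_permHom, coeff_renameEquiv']
  exact hf _ (by rwa [degree_mapDomain])

/-- Modulo `x_a` the map fixes every `x_μ`, hence every polynomial. For general elements this gives
the congruence up to order `n` only; it is sharpened to a true divisibility once the ideal of `x_a`
is known to be closed. -/
theorem sub_latticeHom_mem (σ : M ≃+ M) {a : M} (hσ : ∀ μ, ∃ k : ℤ, σ μ = μ + k • a)
    (s : FGAlg F M) (n : ℕ) :
    s - latticeHom F σ s ∈ Ideal.span {xElt F a} ⊔ fgFilt F M n := by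
  rw [← Ideal.Quotient.eq]
  obtain ⟨f, rfl⟩ := fgMk_surjective F M s
  have := eq_of_var
    (φ := (Ideal.Quotient.mk (Ideal.span {xElt F a} ⊔ fgFilt F M n)).comp (fgMk F M))
    (ψ := (Ideal.Quotient.mk (Ideal.span {xElt F a} ⊔ fgFilt F M n)).comp
      ((latticeHom F σ).comp (fgMk F M))) (n := n)
    (fun f hf => Ideal.Quotient.eq_zero_iff_mem.2
      (Submodule.mem_sup_right (fgMk_mem_fgFilt hf)))
    (fun f hf => Ideal.Quotient.eq_zero_iff_mem.2
      (Submodule.mem_sup_right (latticeHom_mem F σ (fgMk_mem_fgFilt hf))))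
    (fun r => by
      have : permHom R σ.toEquiv (algebraMap R _ r) = algebraMap R _ r :=
        Subtype.ext (AlgEquiv.commutes (renameEquiv R σ.toEquiv) r)
      simp only [RingHom.comp_apply, latticeHom_mk, this])
    (fun μ => by
      refine Ideal.Quotient.eq.2 (Submodule.mem_sup_left (Ideal.mem_span_singleton.2 ?_))
      obtain ⟨k, hk⟩ := hσ μ
      change _ ∣ xElt F μ - latticeHom F σ (xElt F μ)
      rw [latticeHom_xElt, hk, ← dvd_neg, neg_sub]
      exact xElt_dvd_sub_zsmul F μ a k)
  exact DFunLike.congr_fun this f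

end Divisibility

/-- The functional splits the lattice as `ℤa ⊕ ker l`, and the kernel is free. -/
theorem exists_basis_extending {M : Type*} [AddCommGroup M] [Module.Free ℤ M] [Module.Finite ℤ M]
    {l : M →ₗ[ℤ] ℤ} {a : M} (h : l a = 1) :
    ∃ (n : ℕ) (b : Module.Basis (Unit ⊕ Fin n) ℤ M), b (Sum.inl ()) = a := by
  let e : (ℤ × LinearMap.ker l) ≃ₗ[ℤ] M :=
    { toFun := fun p => p.1 • a + p.2
      map_add' := fun p q => by simp [add_smul]; abel
      map_smul' := fun c p => by simp [mul_smul]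
      invFun := fun m => (l m, ⟨m - l m • a, by simp [h]⟩)
      left_inv := fun p => by
        obtain ⟨c, m, hm⟩ := p
        have hm' : l m = 0 := hm
        ext
        · simp [h, hm']
        · simp [h, hm']
      right_inv := fun m => by simp }
  obtain ⟨n, c⟩ := Submodule.basisOfPid (Module.Free.chooseBasis ℤ M) (LinearMap.ker l)
  refine ⟨n, ((Module.Basis.singleton Unit ℤ).prod c).map e, ?_⟩
  simp [e]

section Lattice

variable {R : Type*} [CommRing R] [IsDomain R] (F : FormalGroup R) [F.IsComm]
variable {M : Type*} [AddCommGroup M] [Module.Free ℤ M] [Module.Finite ℤ M]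

instance fgAlg_isDomain : IsDomain (FGAlg F M) :=
  have : IsDomain (MvPowerSeries (Module.Free.ChooseBasisIndex ℤ M) R) :=
    NoZeroDivisors.to_isDomain _
  (fgEquiv F (Module.Free.chooseBasis ℤ M)).toMulEquiv.isDomain _

variable {F} in
theorem isUnit_of_sub_mem {s : FGAlg F M} {r : R} (hr : IsUnit r)
    (h : s - fgMk F M (algebraMap R _ r) ∈ fgFilt F M 1) : IsUnit s := by
  let b := Module.Free.chooseBasis ℤ M
  have h1 : fgEquiv F b (fgMk F M (algebraMap R _ r)) = C r := by
    have : algebraMap R (CompletedPoly R M) r = polyHom R M (MvPolynomial.C r) :=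
      Subtype.ext (MvPolynomial.coe_C r).symm
    change preSeries F b _ = _
    rw [this, preSeries, evalHom_polyHom]
    simp [MvPowerSeries.algebraMap_apply]
  have h2 := fgEquiv_mem F b h
  rw [map_sub, h1, mem_ordGE_one, map_sub, sub_eq_zero] at h2
  rw [← MulEquiv.isUnit_map (fgEquiv F b), isUnit_iff_constantCoeff, h2]
  simpa using hr

/-- One has `x_{2a} = x_a (2 + x_a h)`, and the second factor is a unit when its constant term 2 is.
-/
theorem two_mul_dvd (h2 : IsUnit (2 : R)) (a : M) : xElt F ((2 : ℤ) • a) ∣ xElt F a := by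
  have hu : IsUnit (2 + xElt F a * hElt F a a : FGAlg F M) := by
    refine isUnit_of_sub_mem h2 ?_
    have : fgMk F M (algebraMap R _ (2 : R)) = 2 := by
      rw [map_ofNat, map_ofNat]
    rw [this, add_sub_cancel_left]
    exact Ideal.mul_mem_right _ _ (xElt_mem_fgFilt_one a)
  obtain ⟨u, hu⟩ := hu
  refine ⟨↑u⁻¹, ?_⟩
  have h3 : xElt F ((2 : ℤ) • a) = xElt F a * u := by
    rw [two_smul, xElt_add, hu]
    ring
  rw [h3, mul_assoc, Units.mul_inv, mul_one]

/-- Extending `a` to a basis turns `x_a` into a variable. -/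
theorem prime_xElt {l : M →ₗ[ℤ] ℤ} {a : M} (h : l a = 1) : Prime (xElt F a) := by
  obtain ⟨n, b, rfl⟩ := exists_basis_extending h
  rw [← MulEquiv.prime_iff (fgEquiv F b), fgEquiv_xElt, pointHom_basis]
  exact prime_X _

variable [CharZero R]

/-- In a basis starting with `a`, divisibility by the first variable kills all other linear
coefficients of `x_μ`; these are the remaining coordinates of `μ`, read in a ring of characteristic
0. -/
theorem mem_zmultiples_of_xElt_dvd {l : M →ₗ[ℤ] ℤ} {a μ : M} (h : l a = 1)
    (hdvd : xElt F a ∣ xElt F μ) : ∃ k : ℤ, μ = k • a := by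
  obtain ⟨n, b, rfl⟩ := exists_basis_extending h
  have h1 := map_dvd (fgEquiv F b) hdvd
  rw [fgEquiv_xElt, fgEquiv_xElt, pointHom_basis, X_dvd_iff] at h1
  refine ⟨b.repr μ (Sum.inl ()), ?_⟩
  apply b.repr.injective
  ext j
  rcases j with ⟨⟩ | j
  · simp
  · have := h1 (Finsupp.single (Sum.inr j) 1) (by simp)
    rw [coeff_pointHom] at this
    simpa using this

theorem xElt_ne_zero {μ : M} (h : μ ≠ 0) : xElt F μ ≠ 0 := by
  intro h0
  let b := Module.Free.chooseBasis ℤ M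
  apply h
  apply b.repr.injective
  ext j
  have h1 := coeff_pointHom F b μ j
  rw [← fgEquiv_xElt, h0, map_zero, map_zero] at h1
  simpa using h1.symm

/-- For `a ≠ 0` the series `x_a` has a nonzero linear term, so its principal ideal is closed and the
approximate congruences suffice. No primitivity of `a` is needed. -/
theorem xElt_dvd_sub_latticeHom (σ : M ≃+ M) {a : M} (ha : a ≠ 0)
    (hσ : ∀ μ, ∃ k : ℤ, σ μ = μ + k • a) (s : FGAlg F M) :
    xElt F a ∣ s - latticeHom F σ s := by
  let b := Module.Free.chooseBasis ℤ M
  obtain ⟨i, hi⟩ : ∃ i, b.repr a i ≠ 0 := by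
    by_contra! hcon
    exact ha (b.repr.injective (by ext i; simp [hcon i]))
  rw [← map_dvd_iff (fgEquiv F b)]
  refine dvd_of_forall_ordGE (i := i) ?_ fun n => ?_
  · rw [fgEquiv_xElt, coeff_pointHom]
    exact_mod_cast hi
  · obtain ⟨u, hu, v, hv, huv⟩ := Submodule.mem_sup.1 (sub_latticeHom_mem F σ hσ s n)
    obtain ⟨c, rfl⟩ := Ideal.mem_span_singleton.1 hu
    refine ⟨fgEquiv F b c, ?_⟩
    rw [← huv, map_add, map_mul, add_sub_cancel_left]
    exact fgEquiv_mem F b hv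

end Lattice

/-! ### Real affine roots and the affine Weyl group -/

section Roots

variable {ι X Y : Type*} [AddCommGroup X] [AddCommGroup Y] (P : RootDatum ι X Y)

theorem affRoot_injective : Function.Injective (affRoot P) := by
  intro a c h
  have h1 : P.root a.1 = P.root c.1 := congrArg Prod.fst h
  have h2 : (affRoot P a).2 = (affRoot P c).2 := congrArg Prod.snd h
  exact Prod.ext (P.root.injective h1) h2

theorem affReflection_apply (a : ι × ℤ) (v : X × ℤ) :
    affReflection P a v = v - affCoroot P a v • affRoot P a := by
  simp [affReflection, Module.reflection_apply]

theorem affReflection_zero_affRoot (i : ι) (a : ι × ℤ) :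
    affReflection P (i, 0) (affRoot P a) = affRoot P (P.reflectionPerm i a.1, a.2) := by
  ext
  · simp [affReflection, Module.reflection_apply, affRoot, affCoroot, ← P.reflectionPerm_root,
      RootPairing.coroot']
  · simp [affReflection, Module.reflection_apply, affRoot]

theorem affReflection_zero_fst (i : ι) (v : X × ℤ) :
    (affReflection P (i, 0) v).1 = P.reflection i v.1 := by
  simp [affReflection, Module.reflection_apply, affRoot, affCoroot, RootPairing.reflection_apply]

theorem translation_apply (l : Y) (v : X × ℤ) :
    translation P l v = (v.1, v.2 - P.toLinearMap v.1 l) := rfl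

/-- The pairing is invariant under the generators: translations alter only the `δ`-component, which
coroots ignore. This invariance yields `w s_a w⁻¹ = s_{wa}`. -/
theorem affCoroot_apply_of_mem {w : (X × ℤ) ≃ₗ[ℤ] (X × ℤ)} (hw : w ∈ affWeyl P)
    {a c : ι × ℤ} (h : affRoot P c = w (affRoot P a)) (v : X × ℤ) :
    affCoroot P c (w v) = affCoroot P a v := by
  induction hw using Subgroup.closure_induction'' generalizing a c v with
  | one =>
    obtain rfl : c = a := affRoot_injective P h
    rfl
  | mul g g' hg hg' ihg ihg' =>
    obtain ⟨d, hd⟩ := affWeyl_smul_affRoot P ⟨g', hg'⟩ a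
    have hd' : affRoot P d = g' (affRoot P a) := hd
    rw [← ihg' hd' v]
    refine ihg ?_ (g' v)
    rw [h, hd']
    rfl
  | mem g hg =>
    rcases hg with ⟨i, rfl⟩ | ⟨l, -, rfl⟩
    · have h' : affRoot P c = affReflection P (i, 0) (affRoot P a) := h
      rw [affReflection_zero_affRoot] at h'
      obtain rfl := affRoot_injective P h'
      change P.coroot' (P.reflectionPerm i a.1) (affReflection P (i, 0) v).1 = P.coroot' a.1 v.1
      rw [affReflection_zero_fst, P.coroot'_reflection, P.reflectionPerm_self]
    · have hc : c.1 = a.1 := P.root.injective (congrArg Prod.fst h)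
      change P.coroot' c.1 v.1 = P.coroot' a.1 v.1
      rw [hc]
  | inv_mem g hg =>
    rcases hg with ⟨i, rfl⟩ | ⟨l, -, rfl⟩
    · have hi : (affReflection P (i, 0))⁻¹ = affReflection P (i, 0) := Module.reflection_symm _
      rw [hi] at h ⊢
      rw [affReflection_zero_affRoot] at h
      obtain rfl := affRoot_injective P h
      change P.coroot' (P.reflectionPerm i a.1) (affReflection P (i, 0) v).1 = P.coroot' a.1 v.1
      rw [affReflection_zero_fst, P.coroot'_reflection, P.reflectionPerm_self]
    · have hc : c.1 = a.1 := P.root.injective (congrArg Prod.fst h)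
      change P.coroot' c.1 v.1 = P.coroot' a.1 v.1
      rw [hc]

theorem affReflection_conj {w : (X × ℤ) ≃ₗ[ℤ] (X × ℤ)} (hw : w ∈ affWeyl P)
    {a c : ι × ℤ} (h : affRoot P c = w (affRoot P a)) :
    affReflection P c * w = w * affReflection P a := by
  ext1 v
  change affReflection P c (w v) = w (affReflection P a v)
  rw [affReflection_apply, affReflection_apply, affCoroot_apply_of_mem P hw h, h, map_sub, map_smul]

theorem translation_add (l m : Y) : translation P (l + m) = translation P l * translation P m := by
  ext1 v
  change _ = translation P l (translation P m v)
  ext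
  · rfl
  · simp [translation_apply]
    ring

/-- This makes the lattice of translations in a subgroup containing the finite reflections stable
under the Weyl group. -/
theorem translation_coreflection (k : ι) (l : Y) :
    translation P (P.coreflection k l) =
      affReflection P (k, 0) * translation P l * affReflection P (k, 0) := by
  ext1 v
  change _ = affReflection P (k, 0) (translation P l (affReflection P (k, 0) v))
  ext
  · simp [translation_apply, affReflection_apply, affRoot, affCoroot, RootPairing.coroot']
    module
  · simp [translation_apply, affReflection_apply, affRoot, affCoroot, RootPairing.coroot',
      RootPairing.coreflection_apply, RootPairing.root', mul_comm]

/-- The cocharacters whose translations lie in a subgroup. -/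
def translationLattice (A : Subgroup ((X × ℤ) ≃ₗ[ℤ] (X × ℤ))) : AddSubgroup Y where
  carrier := {l | translation P l ∈ A}
  zero_mem' := by
    have : translation P 0 = 1 := by
      ext1 v
      simp [translation_apply]
    change translation P 0 ∈ A
    rw [this]
    exact one_mem _
  add_mem' := by
    intro l m hl hm
    change translation P (l + m) ∈ A
    rw [translation_add]
    exact mul_mem hl hm
  neg_mem' := by
    intro l hl
    change translation P (-l) ∈ A
    have : translation P (-l) = (translation P l)⁻¹ := by
      rw [eq_inv_iff_mul_eq_one, ← translation_add, neg_add_cancel]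
      ext1 v
      simp [translation_apply]
    rw [this]
    exact inv_mem hl

/-- The cone of the simple roots is pointed because they are linearly independent. -/
theorem eq_zero_of_mem_of_neg_mem {P : RootDatum ι X Y} (b : P.Base) {x : X}
    (h : x ∈ AddSubmonoid.closure (P.root '' b.support))
    (h' : -x ∈ AddSubmonoid.closure (P.root '' b.support)) : x = 0 := by
  have key : ∀ y ∈ AddSubmonoid.closure (P.root '' b.support),
      ∃ f : ι → ℕ, y = ∑ j ∈ b.support, (f j : ℤ) • P.root j := by
    classical
    intro y hy
    induction hy using AddSubmonoid.closure_induction with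
    | zero => exact ⟨0, by simp⟩
    | add y z _ _ hy hz =>
      obtain ⟨f, rfl⟩ := hy
      obtain ⟨g, rfl⟩ := hz
      exact ⟨f + g, by simp [add_smul, Finset.sum_add_distrib]⟩
    | mem y hy =>
      obtain ⟨i, hi, rfl⟩ := hy
      refine ⟨Pi.single i 1, ?_⟩
      rw [Finset.sum_eq_single_of_mem i hi]
      · simp
      · intro j _ hj
        simp [hj]
  obtain ⟨f, hf⟩ := key _ h
  obtain ⟨g, hg⟩ := key _ h'
  have hsum : ∑ j ∈ b.support, ((f j : ℤ) + g j) • P.root j = 0 := by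
    simp only [add_smul, Finset.sum_add_distrib]
    rw [← hf, ← hg, add_neg_cancel]
  have hli := linearIndepOn_iff'.1 b.linearIndepOn_root b.support _ (by simp) hsum
  rw [hf]
  refine Finset.sum_eq_zero fun j hj => ?_
  have := hli j hj
  have h0 : f j = 0 := by omega
  simp [h0]

section HighestRoot

variable {P} {b : P.Base} {θ : ι} (hθ : IsHighestRoot P b θ)
include hθ

/-- Write `β` for the `i`-th root and suppose `k = ⟨β, θ^∨⟩ ≥ 2`. Comparing `θ` with the roots `β`
and `-s_θ(β)` puts `θ - β` and `β - (k-1)θ` in the positive cone, so their sum `-(k-2)θ` lies there,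
while `2θ = θ - (-θ)` does too. Pointedness forces `k = 2`, and then both `θ - β` and `β - θ` are in
the cone, giving `β = θ`. -/
theorem pairing_highest_le_one {i : ι} (hi : i ≠ θ) : P.pairing i θ ≤ 1 := by
  by_contra! hk
  set k := P.pairing i θ with hkdef
  set C := AddSubmonoid.closure (P.root '' b.support) with hC
  let j := P.reflectionPerm θ i
  have hj : P.root j = P.root i - k • P.root θ := by
    rw [P.root_reflectionPerm, P.reflection_apply_root]
  have hneg : ∀ m, P.root (P.reflectionPerm m m) = -P.root m := by
    intro m
    rw [P.root_reflectionPerm, P.reflection_apply_self]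
  have h1 : P.root θ - P.root i ∈ C := hθ i
  have h2 : P.root i - (k - 1) • P.root θ ∈ C := by
    have := hθ (P.reflectionPerm j j)
    rw [hneg, hj] at this
    convert this using 1
    rw [sub_smul, one_smul]
    abel
  have h3 : (2 : ℤ) • P.root θ ∈ C := by
    have := hθ (P.reflectionPerm θ θ)
    rw [hneg] at this
    convert this using 1
    rw [two_smul]
    abel
  obtain ⟨n, hn⟩ : ∃ n : ℕ, k = 2 + n := ⟨(k - 2).toNat, by omega⟩
  have h4 : n • (2 : ℤ) • P.root θ ∈ C := nsmul_mem h3 n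
  have h5 : -(n • (2 : ℤ) • P.root θ) ∈ C := by
    have h12 := nsmul_mem (add_mem h1 h2) 2
    convert h12 using 1
    rw [← natCast_zsmul, ← natCast_zsmul, hn]
    module
  have h6 := eq_zero_of_mem_of_neg_mem b h4 h5
  have h7 := congrArg (P.coroot' θ) h6
  have hn0 : n = 0 := by simpa using h7
  subst hn0
  refine hi (P.root.injective ?_)
  have h8 : P.root i - P.root θ = 0 := by
    refine eq_zero_of_mem_of_neg_mem b ?_ (by simpa using h1)
    convert h2 using 2
    rw [hn]
    simp
  exact sub_eq_zero.1 h8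

theorem pairing_highest (i : ι) :
    i = θ ∨ P.root i = -P.root θ ∨ P.pairing i θ = 0 ∨ P.pairing i θ = 1 ∨ P.pairing i θ = -1 := by
  by_cases h1 : i = θ
  · exact Or.inl h1
  by_cases h2 : P.reflectionPerm i i = θ
  · right; left
    rw [← h2, P.root_reflectionPerm, P.reflection_apply_self, neg_neg]
  have h3 := pairing_highest_le_one hθ h1
  have h4 := pairing_highest_le_one hθ h2
  rw [P.pairing_reflectionPerm_self_left] at h4
  omega

end HighestRoot

/-- The indices of the roots that are conjugate to the `θ`-th root. -/
def rootOrbit (θ : ι) : Set ι :=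
  {i | Relation.ReflTransGen (fun i j => ∃ k, j = P.reflectionPerm k i) θ i}

theorem self_mem_rootOrbit (θ : ι) : θ ∈ rootOrbit P θ := Relation.ReflTransGen.refl

variable {P} in
theorem reflectionPerm_mem_rootOrbit {θ i : ι} (hi : i ∈ rootOrbit P θ) (k : ι) :
    P.reflectionPerm k i ∈ rootOrbit P θ := hi.tail ⟨k, rfl⟩

variable {P} in
theorem rootOrbit_induction {θ : ι} {p : ι → Prop} (h0 : p θ)
    (h1 : ∀ i k, p i → p (P.reflectionPerm k i)) {i : ι} (hi : i ∈ rootOrbit P θ) : p i := by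
  induction hi with
  | refl => exact h0
  | tail _ h ih =>
    obtain ⟨k, rfl⟩ := h
    exact h1 _ k ih

section Simple

variable {P} {b : P.Base} {θ : ι} (hθ : IsHighestRoot P b θ)

include hθ in
theorem pairing_rootOrbit {β : ι} (hβ : β ∈ rootOrbit P θ) : ∀ i,
    i = β ∨ P.root i = -P.root β ∨ P.pairing i β = 0 ∨ P.pairing i β = 1 ∨ P.pairing i β = -1 := by
  refine rootOrbit_induction (p := fun β => ∀ i, i = β ∨ P.root i = -P.root β ∨
    P.pairing i β = 0 ∨ P.pairing i β = 1 ∨ P.pairing i β = -1) (pairing_highest hθ)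
    (fun β k ih i => ?_) hβ
  rw [P.pairing_reflectionPerm]
  rcases ih (P.reflectionPerm k i) with h | h | h
  · left
    rw [← h, P.reflectionPerm_self]
  · right; left
    rw [P.root_reflectionPerm, ← map_neg, ← h, P.root_reflectionPerm, P.reflection_same]
  · exact Or.inr (Or.inr h)

/-- Roots orthogonal to the whole orbit are orthogonal to the rest: if `j` is such and `⟨i, β^∨⟩ ≠
0` with `β` in the orbit, then pairing `j` with the coroot of `s_i(β)` gives `⟨i, β^∨⟩⟨j, i^∨⟩ = 0`.
Irreducibility excludes such `j`. -/
theorem exists_pairing_rootOrbit_ne_zero (hsimple : IsSimpleDatum P) (θ i : ι) :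
    ∃ β ∈ rootOrbit P θ, P.pairing i β ≠ 0 := by
  have hs := hsimple.2 {i | ∃ β ∈ rootOrbit P θ, P.pairing i β ≠ 0}
    ⟨θ, θ, self_mem_rootOrbit P θ, by simp⟩ ?_
  · exact Set.eq_univ_iff_forall.1 hs i
  · rintro i ⟨β, hβ, hne⟩ j hj
    have hj' : ∀ β ∈ rootOrbit P θ, P.pairing j β = 0 := by
      intro β hβ
      by_contra hcon
      exact hj ⟨β, hβ, hcon⟩
    have h1 := hj' _ (reflectionPerm_mem_rootOrbit hβ i)
    rw [← P.root_coroot_eq_pairing, P.coroot_reflectionPerm, P.coreflection_apply_coroot, map_sub,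
      map_smul, P.root_coroot_eq_pairing, P.root_coroot_eq_pairing, hj' β hβ, zero_sub, neg_eq_zero,
      smul_eq_mul] at h1
    rw [P.pairing_eq_zero_iff']
    exact (mul_eq_zero.1 h1).resolve_left hne

include hθ in
-- A pairing equal to 1 lets translations reach every level `i + kδ` from level 0 and writes the
-- coroot of `i` as a difference of coroots from the orbit.
theorem exists_pairing_rootOrbit (hsimple : IsSimpleDatum P) (i : ι) :
    i ∈ rootOrbit P θ ∨ ∃ β ∈ rootOrbit P θ, P.pairing i β = 1 := by
  obtain ⟨β, hβ, hne⟩ := exists_pairing_rootOrbit_ne_zero hsimple θ i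
  rcases pairing_rootOrbit hθ hβ i with h | h | h | h | h
  · exact Or.inl (h ▸ hβ)
  · left
    rw [P.root_eq_neg_iff.1 h]
    exact reflectionPerm_mem_rootOrbit hβ β
  · exact absurd h hne
  · exact Or.inr ⟨β, hβ, h⟩
  · refine Or.inr ⟨P.reflectionPerm β β, reflectionPerm_mem_rootOrbit hβ β, ?_⟩
    rw [P.pairing_reflectionPerm_self_right, h, neg_neg]

theorem translation_mem_affWeyl (i : ι) (m : ℤ) : translation P (m • P.coroot i) ∈ affWeyl P :=
  Subgroup.subset_closure
    (Or.inr ⟨_, Submodule.smul_mem _ _ (Submodule.subset_span ⟨i, rfl⟩), rfl⟩)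

theorem translation_affRoot (j i : ι) (m k : ℤ) :
    affRoot P (i, k - m * P.pairing i j) = translation P (m • P.coroot j) (affRoot P (i, k)) := by
  ext
  · rfl
  · simp [translation_apply, affRoot]

theorem affRoot_eq_or_eq_neg [P.IsReduced] {a c : ι × ℤ} {n k : ℤ} (hn : n ≠ 0)
    (h : n • affRoot P c = k • affRoot P a) :
    affRoot P a = affRoot P c ∨ affRoot P a = -affRoot P c := by
  have h1 : n • P.root c.1 = k • P.root a.1 := congrArg Prod.fst h
  have h2 : n • c.2 = k • a.2 := congrArg Prod.snd h
  have hdep : ¬ LinearIndependent ℤ ![P.root a.1, P.root c.1] := by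
    intro hli
    rw [LinearIndependent.pair_iff] at hli
    have := (hli k (-n) (by rw [neg_smul, h1, add_neg_cancel])).2
    omega
  have h2ne : (P.coroot' c.1) (P.root c.1) = 2 := P.coroot_root_two c.1
  simp only [smul_eq_mul] at h2
  rcases RootPairing.IsReduced.eq_or_eq_neg a.1 c.1 hdep with h3 | h3
  · left
    have hnk : n = k := by
      rw [h3] at h1
      have := congrArg (P.coroot' c.1) h1
      rw [map_smul, map_smul, h2ne, smul_eq_mul, smul_eq_mul] at this
      omega
    subst hnk
    exact Prod.ext h3 (mul_left_cancel₀ hn h2).symm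
  · right
    have hnk : n = -k := by
      rw [h3, smul_neg] at h1
      have := congrArg (P.coroot' c.1) h1
      rw [map_neg, map_smul, map_smul, h2ne, smul_eq_mul, smul_eq_mul] at this
      omega
    subst hnk
    refine Prod.ext h3 ?_
    have hk : k ≠ 0 := by omega
    have : c.2 = -a.2 := mul_left_cancel₀ hk (by linarith)
    change a.2 = -c.2
    omega

theorem affRoot_primitive_or_two_dvd [Module.Free ℤ (X × ℤ)] [Module.Finite ℤ (X × ℤ)]
    (a : ι × ℤ) : (∃ l : (X × ℤ) →ₗ[ℤ] ℤ, l (affRoot P a) = 1) ∨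
      ∃ v : X × ℤ, affRoot P a = (2 : ℤ) • v ∧ ∃ l : (X × ℤ) →ₗ[ℤ] ℤ, l v = 1 := by
  let B := Module.Free.chooseBasis ℤ (X × ℤ)
  have h2 : affCoroot P a (affRoot P a) = 2 := affCoroot_affRoot P a
  by_cases h : ∀ i, Even (B.repr (affRoot P a) i)
  · right
    choose c hc using h
    have hv : affRoot P a = (2 : ℤ) • ∑ i, c i • B i := by
      conv_lhs => rw [← B.sum_repr (affRoot P a)]
      rw [Finset.smul_sum]
      refine Finset.sum_congr rfl fun i _ => ?_
      rw [hc i, add_smul, two_smul]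
    refine ⟨_, hv, affCoroot P a, ?_⟩
    rw [hv, map_smul, smul_eq_mul] at h2
    omega
  · left
    push Not at h
    obtain ⟨i, hi⟩ := h
    obtain ⟨m, hm⟩ := Int.not_even_iff_odd.1 hi
    -- An odd coordinate `2m + 1` is brought down to 1 by the coroot, whose value on the root is 2.
    refine ⟨B.coord i - m • affCoroot P a, ?_⟩
    rw [LinearMap.sub_apply, LinearMap.smul_apply, h2, B.coord_apply, hm, smul_eq_mul]
    ring

variable [Finite ι] [P.IsReduced]

theorem affReflection_mem_of_simple (b : P.Base) {A : Subgroup ((X × ℤ) ≃ₗ[ℤ] (X × ℤ))}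
    (hA : ∀ i ∈ b.support, affReflection P (i, 0) ∈ A) (i : ι) : affReflection P (i, 0) ∈ A := by
  have hconj : ∀ j i, affReflection P (P.reflectionPerm j i, 0) =
      affReflection P (j, 0) * affReflection P (i, 0) * (affReflection P (j, 0))⁻¹ := by
    intro j i
    rw [eq_mul_inv_iff_mul_eq]
    exact affReflection_conj P (affReflection_mem P (j, 0)) (affReflection_zero_affRoot P j (i, 0)).symm
  refine b.induction_reflect i (fun i hi => ?_) hA (fun i j hi hj => ?_)
  · rw [hconj]
    exact mul_mem (mul_mem hi hi) (inv_mem hi)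
  · rw [hconj]
    exact mul_mem (mul_mem (hA j hj) hi) (inv_mem (hA j hj))

include hθ in
/-- The affine Weyl group is generated by the simple affine reflections. -/
theorem affWeyl_le_of_simple (hsimple : IsSimpleDatum P)
    {A : Subgroup ((X × ℤ) ≃ₗ[ℤ] (X × ℤ))}
    (hA : ∀ a ∈ simpleAff P b θ, affReflection P a ∈ A) : affWeyl P ≤ A := by
  have hfin : ∀ i, affReflection P (i, 0) ∈ A :=
    affReflection_mem_of_simple b fun i hi => hA _ (Or.inl ⟨hi, rfl⟩)
  let L := translationLattice P A
  have hstab : ∀ k, ∀ l ∈ L, P.coreflection k l ∈ L := by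
    intro k l hl
    change translation P (P.coreflection k l) ∈ A
    rw [translation_coreflection]
    exact mul_mem (mul_mem (hfin k) hl) (hfin k)
  -- The reflection in `α_0` is `s_θ` followed, on the right, by translation by `-θ^∨`; the finite
  -- reflection is already in `A`.
  have hθL : P.coroot θ ∈ L := by
    have h1 := hA _ (Or.inr rfl : (P.reflectionPerm θ θ, (1 : ℤ)) ∈ simpleAff P b θ)
    rw [affReflection_eq, one_smul, P.coroot_reflectionPerm, P.coreflection_apply_self] at h1
    have h2 : -P.coroot θ ∈ L := (Subgroup.mul_mem_cancel_left A (hfin _)).1 h1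
    simpa using neg_mem h2
  have horb : ∀ β ∈ rootOrbit P θ, P.coroot β ∈ L := by
    intro β hβ
    refine rootOrbit_induction (p := fun β => P.coroot β ∈ L) hθL (fun i k hi => ?_) hβ
    rw [P.coroot_reflectionPerm]
    exact hstab k _ hi
  -- Outside the orbit, `⟨i, β^∨⟩ = 1` gives `i^∨ = β^∨ - s_i(β^∨)`.
  have hall : ∀ i, P.coroot i ∈ L := by
    intro i
    rcases exists_pairing_rootOrbit hθ hsimple i with h | ⟨β, hβ, h⟩
    · exact horb i h
    · have h1 := hstab i _ (horb β hβ)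
      rw [P.coreflection_apply_coroot, h, one_smul] at h1
      have h2 := sub_mem (horb β hβ) h1
      rwa [sub_sub_cancel] at h2
  have hspan : P.corootSpan ℤ ≤ AddSubgroup.toIntSubmodule L := by
    refine Submodule.span_le.2 ?_
    rintro _ ⟨i, rfl⟩
    exact hall i
  refine (Subgroup.closure_le A).2 ?_
  rintro _ (⟨i, rfl⟩ | ⟨l, hl, rfl⟩)
  · exact hfin i
  · exact hspan hl

include hθ in
/-- Every real affine root is conjugate to a simple affine root. -/
theorem affRoot_induction (hsimple : IsSimpleDatum P) {T : ι × ℤ → Prop}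
    (hT : ∀ w ∈ affWeyl P, ∀ a c, T a → affRoot P c = w (affRoot P a) → T c)
    (h : ∀ a ∈ simpleAff P b θ, T a) (a : ι × ℤ) : T a := by
  have hrefl : ∀ i j k, T (i, k) → T (P.reflectionPerm j i, k) := fun i j k hi =>
    hT _ (affReflection_mem P (j, 0)) _ _ hi (affReflection_zero_affRoot P j (i, k)).symm
  have htrans : ∀ i j m k, T (i, k) → T (i, k - m * P.pairing i j) := fun i j m k hi =>
    hT _ (translation_mem_affWeyl j m) _ _ hi (translation_affRoot j i m k)
  have hfin : ∀ i, T (i, 0) := fun i =>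
    b.induction_reflect i (fun i hi => hrefl i i 0 hi) (fun i hi => h _ (Or.inl ⟨hi, rfl⟩))
      (fun i j hi _ => hrefl i j 0 hi)
  obtain ⟨i, k⟩ := a
  rcases exists_pairing_rootOrbit hθ hsimple i with hi | ⟨β, hβ, hp⟩
  · refine rootOrbit_induction ?_ (fun i j hi => hrefl i j k hi) hi
    have hneg : T (P.reflectionPerm θ θ, k) := by
      -- Translations along `θ^∨` shift the level of `-θ` by even numbers only: even levels come
      -- from `-θ`, odd ones from `α_0 = -θ + δ`.
      rcases Int.even_or_odd' k with ⟨m, rfl | rfl⟩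
      · have := htrans _ θ m 0 (hfin (P.reflectionPerm θ θ))
        rw [P.pairing_reflectionPerm_self_left, P.pairing_same] at this
        convert this using 2
        ring
      · have := htrans _ θ m 1 (h _ (Or.inr rfl))
        rw [P.pairing_reflectionPerm_self_left, P.pairing_same] at this
        convert this using 2
        ring
    have := hrefl _ θ k hneg
    rwa [P.reflectionPerm_self] at this
  · have := htrans i β (-k) 0 (hfin i)
    rw [hp] at this
    simpa using this

end Simple

/-- The finitely many coroots generate the cocharacter lattice, which is torsion-free as a reflexive
module and hence free; the character lattice is its dual. -/
theorem free_finite_of_simplyConnected [Finite ι] (hsc : IsSimplyConnectedDatum P) :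
    Module.Free ℤ (X × ℤ) ∧ Module.Finite ℤ (X × ℤ) := by
  have hfinY : Module.Finite ℤ Y := by
    refine ⟨?_⟩
    rw [← hsc]
    exact Submodule.fg_span (Set.finite_range _)
  have : Module.IsReflexive ℤ Y := .of_isPerfPair P.flip.toLinearMap
  have : IsAddTorsionFree Y := .of_isTorsionFree ℤ Y
  have : Module.Free ℤ Y := inferInstance
  have : Module.Free ℤ X := Module.Free.of_equiv P.toLinearMap.toPerfPair.symm
  have : Module.Finite ℤ X := Module.Finite.equiv P.toLinearMap.toPerfPair.symm
  exact ⟨inferInstance, inferInstance⟩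


end Roots

/-! ### Coprimality of the elements attached to affine roots -/

section Coprime

section

variable {ι X Y : Type*} [AddCommGroup X] [AddCommGroup Y] (P : RootDatum ι X Y)

theorem affRoot_ne_zero (a : ι × ℤ) : affRoot P a ≠ 0 := by
  intro h
  have := affCoroot_affRoot P a
  rw [h, map_zero] at this
  norm_num at this

theorem affRoot_sRefl_smul (a : ι × ℤ) (μ : X × ℤ) :
    sRefl P a • μ = μ + (-affCoroot P a μ) • affRoot P a := by
  change affReflection P a μ = _
  rw [affReflection_apply, neg_smul, sub_eq_add_neg]

end

variable {R : Type*} [CommRing R] [IsDomain R] [CharZero R] (F : FormalGroup R) [F.IsComm]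
variable {ι X Y : Type*} [AddCommGroup X] [AddCommGroup Y] (P : RootDatum ι X Y)
variable [Module.Free ℤ (X × ℤ)] [Module.Finite ℤ (X × ℤ)]

/-- If either root is primitive, its `x` is prime and can divide the other only when the roots are
proportional, that is, equal up to sign by reducedness. If both are even, an invertible 2 lets `x_v`
with `a = 2v` replace `x_a`; otherwise the assumption applies. -/
theorem coprimeRoots [P.IsReduced]
    (hcop : ¬ IsUnit (2 : R) → ∀ a c : ι × ℤ,
      (∃ l : X × ℤ, affRoot P a = 2 • l) → (∃ l : X × ℤ, affRoot P c = 2 • l) →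
      affRoot P a ≠ affRoot P c → affRoot P a ≠ -affRoot P c → CoprimeRoots F P a c)
    {a c : ι × ℤ} (h1 : affRoot P a ≠ affRoot P c) (h2 : affRoot P a ≠ -affRoot P c) :
    CoprimeRoots F P a c := by
  have h1' : affRoot P c ≠ affRoot P a := h1.symm
  have h2' : affRoot P c ≠ -affRoot P a := fun h => h2 (by rw [h, neg_neg])
  intro g hg
  rcases affRoot_primitive_or_two_dvd (P := P) a with ⟨l, hl⟩ | ⟨v, hv, l, hl⟩
  · rcases (prime_xElt F hl).dvd_or_dvd hg with h | h
    · obtain ⟨k, hk⟩ := mem_zmultiples_of_xElt_dvd F hl h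
      rcases affRoot_eq_or_eq_neg (P := P) (a := a) (c := c) (n := 1) (k := k) one_ne_zero
        ((one_smul ℤ _).trans hk) with h | h
      · exact absurd h h1
      · exact absurd h h2
    · exact h
  rcases affRoot_primitive_or_two_dvd (P := P) c with ⟨l', hl'⟩ | ⟨u, hu, -⟩
  · have hp := prime_xElt F hl'
    obtain ⟨y, hy⟩ := hg
    have hdvd : xRoot F P c ∣ xRoot F P a * y := ⟨g, hy.symm⟩
    rcases hp.dvd_or_dvd hdvd with h | ⟨y', rfl⟩
    · obtain ⟨k, hk⟩ := mem_zmultiples_of_xElt_dvd F hl' h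
      rcases affRoot_eq_or_eq_neg (P := P) (a := c) (c := a) (n := 1) (k := k) one_ne_zero
        ((one_smul ℤ _).trans hk) with h | h
      · exact absurd h h1'
      · exact absurd h h2'
    · refine ⟨y', mul_left_cancel₀ hp.ne_zero ?_⟩
      change xRoot F P c * g = xRoot F P c * (xRoot F P a * y')
      rw [hy]
      change xRoot F P a * (xRoot F P c * y') = _
      ring
  by_cases hunit : IsUnit (2 : R)
  · have hva : xElt F v ∣ xRoot F P a := by
      rw [xRoot, hv]
      exact xElt_dvd_zsmul F v 2
    have hav : xRoot F P a ∣ xElt F v := by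
      rw [xRoot, hv]
      exact two_mul_dvd F hunit v
    rcases (prime_xElt F hl).dvd_or_dvd (hva.trans hg) with h | h
    · obtain ⟨k, hk⟩ := mem_zmultiples_of_xElt_dvd F hl h
      have h2k : (2 : ℤ) • affRoot P c = k • affRoot P a := by
        rw [hv, smul_comm]
        exact congrArg _ hk
      rcases affRoot_eq_or_eq_neg (P := P) (a := a) (c := c) two_ne_zero h2k with h | h
      · exact absurd h h1
      · exact absurd h h2
    · exact hav.trans h
  · exact hcop hunit a c ⟨v, by rw [hv, ofNat_zsmul]⟩ ⟨u, by rw [hu, ofNat_zsmul]⟩ h1 h2 g hg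

theorem xRoot_ne_zero (a : ι × ℤ) : xRoot F P a ≠ 0 := xElt_ne_zero F (affRoot_ne_zero P a)

theorem rootSubmonoid_le_nonZeroDivisors : rootSubmonoid F P ≤ nonZeroDivisors (SHat F P) := by
  refine Submonoid.closure_le.2 ?_
  rintro _ ⟨a, rfl⟩
  exact mem_nonZeroDivisors_of_ne_zero (xRoot_ne_zero F P a)

theorem algebraMap_injective : Function.Injective (algebraMap (SHat F P) (QHat F P)) :=
  IsLocalization.injective _ (rootSubmonoid_le_nonZeroDivisors F P)

theorem xRoot_dvd_sub_smul (a : ι × ℤ) (s : SHat F P) : xRoot F P a ∣ s - sRefl P a • s :=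
  xElt_dvd_sub_latticeHom F (DistribMulAction.toAddEquiv (X × ℤ) (sRefl P a))
    (affRoot_ne_zero P a) (fun μ => ⟨_, affRoot_sRefl_smul P a μ⟩) s

end Coprime

/-! ### Computations in the localized twisted group algebra -/

section Twisted

variable {R : Type*} [CommRing R] (F : FormalGroup R)
variable {ι X Y : Type*} [AddCommGroup X] [AddCommGroup Y] (P : RootDatum ι X Y)

theorem invX_mul (a : ι × ℤ) : invX F P a * algebraMap (SHat F P) (QHat F P) (xRoot F P a) = 1 := by
  rw [invX, ← Localization.mk_one_eq_algebraMap, Localization.mk_mul]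
  simp only [one_mul, mul_one]
  exact Localization.mk_self
    (⟨xRoot F P a, Submonoid.subset_closure ⟨a, rfl⟩⟩ : rootSubmonoid F P)

theorem smul_algebraMap (w : affWeyl P) (s : SHat F P) :
    w • algebraMap (SHat F P) (QHat F P) s = algebraMap (SHat F P) (QHat F P) (w • s) :=
  qHom_algebraMap F P w s

theorem smul_xRoot {w : affWeyl P} {a c : ι × ℤ} (h : affRoot P c = w • affRoot P a) :
    w • xRoot F P a = xRoot F P c := by
  exact (smul_xElt F w (affRoot P a)).trans (congrArg _ h.symm)

theorem smul_invX {w : affWeyl P} {a c : ι × ℤ} (h : affRoot P c = w • affRoot P a) :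
    w • invX F P a = invX F P c := by
  have h1 := congrArg (fun q => w • q) (invX_mul F P a)
  simp only [smul_mul', smul_one, smul_algebraMap, smul_xRoot F P h] at h1
  have h2 := invX_mul F P c
  calc w • invX F P a
      = w • invX F P a * (invX F P c * algebraMap (SHat F P) (QHat F P) (xRoot F P c)) := by
        rw [h2, mul_one]
    _ = (w • invX F P a * algebraMap (SHat F P) (QHat F P) (xRoot F P c)) * invX F P c := by ring
    _ = invX F P c := by rw [h1, one_mul]

theorem single_eq_smul_eta (w : affWeyl P) (q : QHat F P) :
    (SkewMonoidAlgebra.single w q : QW F P) = q • eta F P w := by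
  rw [eta, SkewMonoidAlgebra.smul_single, smul_eq_mul, mul_one]

theorem eta_one : eta F P 1 = 1 := rfl

theorem eta_mul_eta (v w : affWeyl P) : eta F P v * eta F P w = eta F P (v * w) := by
  simp [eta, SkewMonoidAlgebra.single_mul_single]

theorem smul_eq_single_mul (q : QHat F P) (z : QW F P) :
    q • z = SkewMonoidAlgebra.single 1 q * z := by
  induction z using SkewMonoidAlgebra.induction_on' with
  | single w q => simp [SkewMonoidAlgebra.smul_single, SkewMonoidAlgebra.single_mul_single]
  | add f g hf hg => rw [smul_add, mul_add, hf, hg]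

theorem smul_mul_assoc_QW (q : QHat F P) (y z : QW F P) : (q • y) * z = q • (y * z) := by
  rw [smul_eq_single_mul, smul_eq_single_mul, mul_assoc]

theorem eta_mul_smul (w : affWeyl P) (q : QHat F P) (z : QW F P) :
    eta F P w * (q • z) = (w • q) • (eta F P w * z) := by
  rw [smul_eq_single_mul, smul_eq_single_mul, ← mul_assoc, ← mul_assoc]
  congr 1
  simp [eta, SkewMonoidAlgebra.single_mul_single]

theorem sRefl_conj {w : affWeyl P} {a c : ι × ℤ} (h : affRoot P c = w • affRoot P a) :
    sRefl P c * w = w * sRefl P a :=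
  Subtype.ext (affReflection_conj P w.2 h)

/-- Right multiplication by a Demazure element thus acts on functionals as a divided difference
along the moving root `wa`. -/
theorem eta_mul_demazure {w : affWeyl P} {a c : ι × ℤ} (h : affRoot P c = w • affRoot P a) :
    eta F P w * demazure F P a = invX F P c • (eta F P w - eta F P (sRefl P c * w)) := by
  rw [demazure, eta_mul_smul, smul_invX F P h, mul_sub, mul_one, eta_mul_eta, sRefl_conj P h]

theorem demazure_mul_eta (c : ι × ℤ) (w : affWeyl P) :
    demazure F P c * eta F P w = invX F P c • (eta F P w - eta F P (sRefl P c * w)) := by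
  rw [demazure, smul_mul_assoc_QW, sub_mul, one_mul, eta_mul_eta]

theorem algebraMap_smul_QW (s : SHat F P) (z : QW F P) :
    algebraMap (SHat F P) (QHat F P) s • z = s • z := algebraMap_smul _ s z

theorem xRoot_smul_demazure_mul_eta (c : ι × ℤ) (w : affWeyl P) :
    xRoot F P c • (demazure F P c * eta F P w) = eta F P w - eta F P (sRefl P c * w) := by
  rw [demazure_mul_eta, ← algebraMap_smul_QW, smul_smul, mul_comm, invX_mul, one_smul]

theorem linear_ext_eta {f g : QWDual F P} (h : ∀ w, f (eta F P w) = g (eta F P w)) : f = g := by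
  refine LinearMap.ext fun z => ?_
  induction z using SkewMonoidAlgebra.induction_on' with
  | single w q => rw [single_eq_smul_eta, map_smul, map_smul, h]
  | add y z hy hz => rw [map_add, map_add, hy, hz]

/-- The linear functional with prescribed values on the basis elements `η_w`. -/
def extendEta (g : affWeyl P → QHat F P) : QWDual F P :=
  SkewMonoidAlgebra.basisSingleOne.constr (QHat F P) g

theorem extendEta_eta (g : affWeyl P → QHat F P) (w : affWeyl P) :
    extendEta F P g (eta F P w) = g w := by
  have : eta F P w = SkewMonoidAlgebra.basisSingleOne w := by
    apply SkewMonoidAlgebra.basisSingleOne.repr.injective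
    rw [Module.Basis.repr_self]
    rfl
  rw [this]
  exact Module.Basis.constr_basis _ _ _ _

theorem mul_smul_QW (s t : SHat F P) (z : QW F P) : (s * t) • z = s • t • z := by
  simp only [← algebraMap_smul_QW, map_mul, mul_smul]

theorem map_smul_QW (f : QWDual F P) (s : SHat F P) (z : QW F P) :
    f (s • z) = algebraMap (SHat F P) (QHat F P) s * f z := by
  rw [← algebraMap_smul_QW]
  exact f.map_smul _ z

/-- Every element of the localized algebra has a denominator. -/
theorem exists_smul_mem_span_eta (z : QW F P) :
    ∃ d ∈ rootSubmonoid F P, d • z ∈ Submodule.span (SHat F P) (Set.range (eta F P)) := by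
  induction z using SkewMonoidAlgebra.induction_on' with
  | single w q =>
    obtain ⟨⟨s, d⟩, hsd⟩ := IsLocalization.surj (rootSubmonoid F P) q
    refine ⟨d, d.2, ?_⟩
    have : (d : SHat F P) • (SkewMonoidAlgebra.single w q : QW F P) = s • eta F P w := by
      rw [single_eq_smul_eta, ← algebraMap_smul_QW, ← algebraMap_smul_QW, smul_smul, mul_comm]
      exact congrArg (fun q => q • eta F P w) hsd
    rw [this]
    exact Submodule.smul_mem _ _ (Submodule.subset_span ⟨w, rfl⟩)
  | add y z hy hz =>
    obtain ⟨d, hd, hdy⟩ := hy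
    obtain ⟨e, he, hez⟩ := hz
    refine ⟨d * e, mul_mem hd he, ?_⟩
    rw [smul_add]
    refine add_mem ?_ ?_
    · rw [mul_comm, mul_smul_QW]
      exact Submodule.smul_mem _ _ hdy
    · rw [mul_smul_QW]
      exact Submodule.smul_mem _ _ hez

end Twisted

/-! ### The Demazure algebra and the extension of functionals -/

section DemazureAlgebra

variable {R : Type*} [CommRing R] (F : FormalGroup R)
variable {ι X Y : Type*} [AddCommGroup X] [AddCommGroup Y] {P : RootDatum ι X Y}
variable {b : P.Base} {θ : ι}

theorem eta_sRefl_mem {a : ι × ℤ} (ha : a ∈ simpleAff P b θ) :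
    eta F P (sRefl P a) ∈ fadaRing F P b θ := by
  have h1 := xRoot_smul_demazure_mul_eta F P a 1
  rw [mul_one, eta_one, mul_one] at h1
  have h2 : eta F P (sRefl P a) = 1 - xRoot F P a • demazure F P a := by rw [h1, sub_sub_cancel]
  rw [h2]
  exact sub_mem (one_mem _) ((fada F P b θ).smul_mem _
    (Subring.subset_closure (Or.inr ⟨a, ha, rfl⟩)))

theorem sRefl_inv (a : ι × ℤ) : (sRefl P a)⁻¹ = sRefl P a :=
  Subtype.ext (Module.reflection_symm (affCoroot_affRoot P a))

variable [Finite ι] [P.IsReduced] (hsimple : IsSimpleDatum P) (hθ : IsHighestRoot P b θ)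

include hsimple hθ

theorem eta_mem (w : affWeyl P) : eta F P w ∈ fadaRing F P b θ := by
  -- A subring need not contain inverses, so membership is recorded for `w` and `w⁻¹` together.
  let A : Subgroup (affWeyl P) :=
    { carrier := {w | eta F P w ∈ fadaRing F P b θ ∧ eta F P w⁻¹ ∈ fadaRing F P b θ}
      one_mem' := ⟨by rw [eta_one]; exact one_mem _, by rw [inv_one, eta_one]; exact one_mem _⟩
      mul_mem' := by
        rintro v w ⟨hv, hv'⟩ ⟨hw, hw'⟩
        refine ⟨?_, ?_⟩
        · rw [← eta_mul_eta]
          exact mul_mem hv hw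
        · rw [mul_inv_rev, ← eta_mul_eta]
          exact mul_mem hw' hv'
      inv_mem' := by
        rintro w ⟨hw, hw'⟩
        exact ⟨hw', by rwa [inv_inv]⟩ }
  have hle := affWeyl_le_of_simple hθ hsimple (A := A.map (affWeyl P).subtype) (fun a ha =>
    ⟨sRefl P a, ⟨eta_sRefl_mem F ha, by rw [sRefl_inv]; exact eta_sRefl_mem F ha⟩, rfl⟩)
  obtain ⟨v, hv, hvw⟩ := hle w.2
  obtain rfl : v = w := Subtype.ext hvw
  exact hv.1

theorem demazure_mem (a : ι × ℤ) : demazure F P a ∈ fadaRing F P b θ := by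
  refine affRoot_induction hθ hsimple (T := fun a => demazure F P a ∈ fadaRing F P b θ) ?_ ?_ a
  · intro w hw a c ha hc
    have hc' : affRoot P c = (⟨w, hw⟩ : affWeyl P) • affRoot P a := hc
    have h1 : demazure F P c * eta F P ⟨w, hw⟩ = eta F P ⟨w, hw⟩ * demazure F P a := by
      rw [eta_mul_demazure F P hc', demazure_mul_eta]
    have h2 : demazure F P c =
        eta F P ⟨w, hw⟩ * demazure F P a * eta F P (⟨w, hw⟩ : affWeyl P)⁻¹ := by
      rw [← h1, mul_assoc, eta_mul_eta, mul_inv_cancel, eta_one, mul_one]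
    rw [h2]
    exact mul_mem (mul_mem (eta_mem F hsimple hθ _) ha) (eta_mem F hsimple hθ _)
  · intro a ha
    exact Subring.subset_closure (Or.inr ⟨a, ha, rfl⟩)

/-- Agreement on the `Ŝ`-span of the `η_w` spreads to all of `D̂` by clearing denominators, which
are units in `Q̂`; no basis of `D̂` is required. -/
theorem extends_of_eta {φ : fada F P b θ →ₗ[SHat F P] SHat F P} {f : QWDual F P}
    (h : ∀ w, f (eta F P w) =
      algebraMap (SHat F P) (QHat F P) (φ ⟨eta F P w, eta_mem F hsimple hθ w⟩)) :
    Extends F P b θ φ f := by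
  have key : ∀ y ∈ Submodule.span (SHat F P) (Set.range (eta F P)), ∀ hy : y ∈ fada F P b θ,
      f y = algebraMap (SHat F P) (QHat F P) (φ ⟨y, hy⟩) := by
    have hle : Submodule.span (SHat F P) (Set.range (eta F P)) ≤ fada F P b θ := by
      refine Submodule.span_le.2 ?_
      rintro _ ⟨w, rfl⟩
      exact eta_mem F hsimple hθ w
    intro y hy
    induction hy using Submodule.span_induction with
    | mem y hy =>
      obtain ⟨w, rfl⟩ := hy
      exact fun _ => h w
    | zero =>
      intro h0
      have : (⟨0, h0⟩ : fada F P b θ) = 0 := rfl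
      rw [this, map_zero, map_zero, map_zero]
    | add y z hy hz ihy ihz =>
      intro hyz
      have : (⟨y + z, hyz⟩ : fada F P b θ) = ⟨y, hle hy⟩ + ⟨z, hle hz⟩ := rfl
      rw [this, map_add, map_add, map_add, ihy, ihz]
    | smul s y hy ih =>
      intro hsy
      have : (⟨s • y, hsy⟩ : fada F P b θ) = s • ⟨y, hle hy⟩ := rfl
      rw [this, map_smul_QW, φ.map_smul, smul_eq_mul, map_mul, ← ih]
  intro z
  obtain ⟨d, hd, hdz⟩ := exists_smul_mem_span_eta F P (z : QW F P)
  have h1 := key _ hdz (d • z).2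
  have h2 : (⟨d • (z : QW F P), (d • z).2⟩ : fada F P b θ) = d • z := rfl
  rw [h2, map_smul_QW, φ.map_smul, smul_eq_mul, map_mul] at h1
  exact (IsLocalization.map_units (QHat F P) (⟨d, hd⟩ : rootSubmonoid F P)).mul_left_cancel h1

theorem existsUnique_extends (φ : fada F P b θ →ₗ[SHat F P] SHat F P) :
    ∃! f : QWDual F P, Extends F P b θ φ f := by
  refine ⟨extendEta F P fun w =>
    algebraMap (SHat F P) (QHat F P) (φ ⟨eta F P w, eta_mem F hsimple hθ w⟩), ?_, ?_⟩
  · exact extends_of_eta F hsimple hθ fun w => extendEta_eta F P _ w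
  · intro g hg
    refine linear_ext_eta F P fun w => ?_
    rw [extendEta_eta]
    exact hg ⟨eta F P w, eta_mem F hsimple hθ w⟩

theorem fadaDual_subset_gkmSet : fadaDual F P b θ ⊆ gkmSet F P := by
  rintro f ⟨φ, hφ⟩
  refine ⟨fun w => ⟨_, hφ ⟨eta F P w, eta_mem F hsimple hθ w⟩⟩, fun a w => ?_⟩
  have hz : demazure F P a * eta F P w ∈ fadaRing F P b θ :=
    mul_mem (demazure_mem F hsimple hθ a) (eta_mem F hsimple hθ w)
  let z : fada F P b θ := ⟨demazure F P a * eta F P w, hz⟩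
  refine ⟨φ z, ?_⟩
  rw [← xRoot_smul_demazure_mul_eta, map_smul_QW,
    map_mul (algebraMap (SHat F P) (QHat F P))]
  exact congrArg _ (hφ z)

end DemazureAlgebra

/-! ### Families satisfying the GKM divisibilities -/

section GKM

variable {R : Type*} [CommRing R] (F : FormalGroup R)
variable {ι X Y : Type*} [AddCommGroup X] [AddCommGroup Y] (P : RootDatum ι X Y)

/-- Right multiplication by `z`, as a `Q̂`-linear map. -/
def mulRightQW (z : QW F P) : QW F P →ₗ[QHat F P] QW F P where
  toFun y := y * z
  map_add' y y' := add_mul y y' z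
  map_smul' q y := smul_mul_assoc_QW F P q y z

/-- The divisibility conditions cutting out the GKM functionals, for the values on the `η_w`. -/
def IsGKM (g : affWeyl P → SHat F P) : Prop :=
  ∀ (a : ι × ℤ) (w : affWeyl P), xRoot F P a ∣ g w - g (sRefl P a * w)

variable {F P}

theorem IsGKM.add {g g' : affWeyl P → SHat F P} (hg : IsGKM F P g) (hg' : IsGKM F P g') :
    IsGKM F P (g + g') := fun a w => by
  have := dvd_add (hg a w) (hg' a w)
  rwa [sub_add_sub_comm] at this

theorem IsGKM.neg {g : affWeyl P → SHat F P} (hg : IsGKM F P g) : IsGKM F P (-g) := fun a w => by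
  have := (dvd_neg (α := SHat F P)).2 (hg a w)
  rw [neg_sub] at this
  refine this.trans (dvd_of_eq ?_)
  simp only [Pi.neg_apply]
  ring

theorem sRefl_smul_affRoot_self (a : ι × ℤ) : sRefl P a • affRoot P a = -affRoot P a := by
  rw [affRoot_sRefl_smul, affCoroot_affRoot, neg_smul, two_smul]
  abel

theorem sRefl_eq_of_affRoot_eq_neg {a c : ι × ℤ} (h : affRoot P c = -affRoot P a) :
    sRefl P c = sRefl P a := by
  have h1 := sRefl_conj P (h.trans (sRefl_smul_affRoot_self a).symm)
  exact mul_right_cancel h1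

theorem sRefl_mul_self (a : ι × ℤ) : sRefl P a * sRefl P a = 1 := by
  rw [mul_eq_one_iff_eq_inv, sRefl_inv]

end GKM

/-! ### Stability of the GKM condition under the Demazure algebra -/

section Stability

variable {R : Type*} [CommRing R] [IsDomain R] [CharZero R] (F : FormalGroup R) [F.IsComm]
variable {ι X Y : Type*} [AddCommGroup X] [AddCommGroup Y] (P : RootDatum ι X Y)
variable [Module.Free ℤ (X × ℤ)] [Module.Finite ℤ (X × ℤ)]

theorem mem_gkmSet_iff {f : QWDual F P} :
    f ∈ gkmSet F P ↔ ∃ g : affWeyl P → SHat F P,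
      (∀ w, f (eta F P w) = algebraMap (SHat F P) (QHat F P) (g w)) ∧ IsGKM F P g := by
  constructor
  · rintro ⟨h1, h2⟩
    choose g hg using h1
    refine ⟨g, hg, fun a w => ?_⟩
    obtain ⟨s, hs⟩ := h2 a w
    refine ⟨s, algebraMap_injective F P ?_⟩
    rw [← hs, f.map_sub, hg, hg, map_sub]
  · rintro ⟨g, hg, h⟩
    refine ⟨fun w => ⟨g w, hg w⟩, fun a w => ?_⟩
    obtain ⟨s, hs⟩ := h a w
    exact ⟨s, by rw [f.map_sub, hg, hg, ← map_sub, hs]⟩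

variable {F P}

/-- A product rule: the difference splits into `(ws - s_a ws) g(w)` and `(s_a ws)(g(w) - g(s_a w))`.
-/
theorem IsGKM.smul_mul {g : affWeyl P → SHat F P} (hg : IsGKM F P g) (s : SHat F P) :
    IsGKM F P fun w => (w • s) * g w := fun a w => by
  have h1 := (xRoot_dvd_sub_smul F P a (w • s)).mul_right (g w)
  have h2 := (hg a w).mul_left ((sRefl P a * w) • s)
  have h3 := dvd_add h1 h2
  rw [smul_smul] at h3
  refine h3.trans (dvd_of_eq ?_)
  ring

/-- Since `x_a = -x_{-a}(1 + x_a h)`, the quotients satisfy `q = p(1 + x_a h)`. -/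
theorem dvd_quotient_sub_quotient_of_neg {a c : ι × ℤ} (h : affRoot P c = -affRoot P a)
    {p q u : SHat F P} (hp : u = xRoot F P a * p) (hq : -u = xRoot F P c * q) :
    xRoot F P a ∣ p - q := by
  have h1 := xElt_neg_relation F (affRoot P a)
  rw [← h] at h1
  have h2 : xRoot F P c * q
      = xRoot F P c * (p * (1 + xRoot F P a * hElt F (affRoot P a) (-affRoot P a))) := by
    rw [← hq, hp]
    conv_lhs => rw [xRoot, h1]
    rw [xRoot, xRoot, ← h]
    ring
  have h3 := mul_left_cancel₀ (xRoot_ne_zero F P c) h2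
  refine ⟨-(hElt F (affRoot P a) (-affRoot P a) * p), ?_⟩
  rw [h3]
  ring

/-- Fix `d` and compare `w` with `s_d w`, whose roots are `c` and `c' = s_d(c)`. If `d = ±c`, then
`c' = -c` and the numerators are opposite. Otherwise both the numerators and `x_c`, `x_{c'}` agree
modulo `x_d`, so `x_d` divides `x_c x_{c'}(q - q')`, and both factors cancel by coprimality. -/
theorem IsGKM.divided_difference
    (hcop : ∀ a c : ι × ℤ, affRoot P a ≠ affRoot P c → affRoot P a ≠ -affRoot P c →
      CoprimeRoots F P a c)
    {g : affWeyl P → SHat F P} (hg : IsGKM F P g) {a : ι × ℤ} {c : affWeyl P → ι × ℤ}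
    (hc : ∀ w, affRoot P (c w) = w • affRoot P a) {q : affWeyl P → SHat F P}
    (hq : ∀ w, g w - g (sRefl P (c w) * w) = xRoot F P (c w) * q w) : IsGKM F P q := by
  intro d w
  have hcc : affRoot P (c (sRefl P d * w)) = sRefl P d • affRoot P (c w) := by
    rw [hc, hc, mul_smul]
  have hconj : sRefl P (c (sRefl P d * w)) * sRefl P d = sRefl P d * sRefl P (c w) :=
    sRefl_conj P hcc
  have hq1 := hq w
  have hq2 := hq (sRefl P d * w)
  rw [← mul_assoc, hconj, mul_assoc] at hq2
  by_cases h1 : affRoot P d = affRoot P (c w) ∨ affRoot P d = -affRoot P (c w)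
  · have hs : sRefl P d = sRefl P (c w) := by
      rcases h1 with h1 | h1
      · rw [affRoot_injective P h1]
      · exact sRefl_eq_of_affRoot_eq_neg h1
    have hdvd : xRoot F P d ∣ xRoot F P (c w) := by
      rcases h1 with h1 | h1
      · rw [xRoot, h1, xRoot]
      · rw [xRoot, h1]
        exact xElt_neg_dvd F _
    refine hdvd.trans (dvd_quotient_sub_quotient_of_neg (c := c (sRefl P d * w)) ?_ hq1 ?_)
    · rw [hcc, hs, sRefl_smul_affRoot_self]
    · rw [← hq2, hs, ← mul_assoc, sRefl_mul_self, one_mul]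
      ring
  · push Not at h1
    have h2 : affRoot P d ≠ affRoot P (c (sRefl P d * w)) ∧
        affRoot P d ≠ -affRoot P (c (sRefl P d * w)) := by
      have hinv : affRoot P (c w) = sRefl P d • affRoot P (c (sRefl P d * w)) := by
        rw [hcc, smul_smul, sRefl_mul_self, one_smul]
      refine ⟨fun h => h1.2 ?_, fun h => h1.1 ?_⟩
      · rw [hinv, ← h, sRefl_smul_affRoot_self, neg_neg]
      · rw [hinv, ← neg_eq_iff_eq_neg.2 h, smul_neg, sRefl_smul_affRoot_self, neg_neg]
    refine hcop d _ h1.1 h1.2 _ (hcop d _ h2.1 h2.2 _ ?_)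
    have hx : xRoot F P d ∣ xRoot F P (c (sRefl P d * w)) - xRoot F P (c w) := by
      have := xElt_dvd_sub_zsmul F (affRoot P (c w)) (affRoot P d)
        (-affCoroot P d (affRoot P (c w)))
      rwa [← affRoot_sRefl_smul, ← hcc] at this
    have e1 := hg d w
    have e2 := hg d (sRefl P (c w) * w)
    -- With `N = x_c q` and `N' = x_{c'} q'` this is `(x_{c'} - x_c)N + x_c(N - N') = x_{c'}N - x_c
    -- N'`.
    have key := dvd_add (hx.mul_right (g w - g (sRefl P (c w) * w)))
      ((dvd_sub e1 e2).mul_left (xRoot F P (c w)))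
    refine key.trans (dvd_of_eq ?_)
    have e3 : g w - g (sRefl P d * w) -
        (g (sRefl P (c w) * w) - g (sRefl P d * (sRefl P (c w) * w))) =
        xRoot F P (c w) * q w - xRoot F P (c (sRefl P d * w)) * q (sRefl P d * w) := by
      rw [← hq1, ← hq2]
      ring
    rw [e3, hq1]
    ring

variable (F P)

theorem comp_mulRight_mem_gkmSet {b : P.Base} {θ : ι}
    (hcop : ∀ a c : ι × ℤ, affRoot P a ≠ affRoot P c → affRoot P a ≠ -affRoot P c →
      CoprimeRoots F P a c)
    {z : QW F P} (hz : z ∈ fadaRing F P b θ) {f : QWDual F P} (hf : f ∈ gkmSet F P) :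
    f.comp (mulRightQW F P z) ∈ gkmSet F P := by
  induction hz using Subring.closure_induction generalizing f with
  | mem z hz =>
    rw [mem_gkmSet_iff] at hf ⊢
    obtain ⟨g, hfg, hg⟩ := hf
    rcases hz with ⟨s, rfl⟩ | ⟨a, -, rfl⟩
    · refine ⟨_, fun w => ?_, hg.smul_mul s⟩
      change f (eta F P w * s • (1 : QW F P)) = _
      rw [← algebraMap_smul_QW, eta_mul_smul, mul_one, smul_algebraMap, f.map_smul, hfg, map_mul,
        smul_eq_mul]
    · choose c hc using fun w : affWeyl P => affWeyl_smul_affRoot P w a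
      choose q hq using fun w => hg (c w) w
      refine ⟨q, fun w => ?_, hg.divided_difference hcop hc hq⟩
      change f (eta F P w * demazure F P a) = _
      rw [eta_mul_demazure F P (hc w), f.map_smul, f.map_sub, hfg, hfg, ← map_sub, hq, map_mul,
        smul_eq_mul, ← mul_assoc, invX_mul, one_mul]
  | zero =>
    rw [mem_gkmSet_iff]
    refine ⟨0, fun w => ?_, fun a w => by simp⟩
    change f (eta F P w * 0) = _
    rw [mul_zero, f.map_zero, Pi.zero_apply, map_zero]
  | one =>
    convert hf using 1
    refine LinearMap.ext fun y => ?_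
    change f (y * 1) = f y
    rw [mul_one]
  | add y z _ _ ihy ihz =>
    obtain ⟨g, hg, h⟩ := (mem_gkmSet_iff F P).1 (ihy hf)
    obtain ⟨g', hg', h'⟩ := (mem_gkmSet_iff F P).1 (ihz hf)
    refine (mem_gkmSet_iff F P).2 ⟨g + g', fun w => ?_, h.add h'⟩
    rw [Pi.add_apply, map_add, ← hg, ← hg']
    change f (eta F P w * (y + z)) = f (eta F P w * y) + f (eta F P w * z)
    rw [mul_add, f.map_add]
  | neg z _ ih =>
    obtain ⟨g, hg, h⟩ := (mem_gkmSet_iff F P).1 (ih hf)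
    refine (mem_gkmSet_iff F P).2 ⟨-g, fun w => ?_, h.neg⟩
    rw [Pi.neg_apply, map_neg, ← hg]
    change f (eta F P w * -z) = -f (eta F P w * z)
    exact (congrArg f (mul_neg (eta F P w) z)).trans (f.map_neg _)
  | mul y z _ _ ihy ihz =>
    -- Right multiplications compose in reverse, so `z` is applied to `f` before `y`; the induction
    -- must therefore range over all `f`.
    have := ihy (ihz hf)
    convert this using 1
    refine LinearMap.ext fun v => ?_
    change f (v * (y * z)) = f (v * y * z)
    rw [mul_assoc]

theorem gkmSet_subset_fadaDual {b : P.Base} {θ : ι}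
    (hcop : ∀ a c : ι × ℤ, affRoot P a ≠ affRoot P c → affRoot P a ≠ -affRoot P c →
      CoprimeRoots F P a c) :
    gkmSet F P ⊆ fadaDual F P b θ := by
  intro f hf
  have h : ∀ z : fada F P b θ, ∃ s : SHat F P,
      f (z : QW F P) = algebraMap (SHat F P) (QHat F P) s := by
    intro z
    obtain ⟨s, hs⟩ := (comp_mulRight_mem_gkmSet F P hcop z.2 hf).1 1
    refine ⟨s, ?_⟩
    rw [← hs]
    change f (z : QW F P) = f (eta F P 1 * (z : QW F P))
    rw [eta_one, one_mul]
  choose φ hφ using h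
  refine ⟨{ toFun := φ, map_add' := fun y z => ?_, map_smul' := fun s z => ?_ }, hφ⟩
  · apply algebraMap_injective F P
    rw [map_add, ← hφ, ← hφ, ← hφ]
    exact f.map_add _ _
  · apply algebraMap_injective F P
    rw [RingHom.id_apply, smul_eq_mul, map_mul, ← hφ, ← hφ]
    exact map_smul_QW F P f s _

theorem eq_of_extends {b : P.Base} {θ : ι} {φ ψ : fada F P b θ →ₗ[SHat F P] SHat F P}
    {f : QWDual F P} (hφ : Extends F P b θ φ f) (hψ : Extends F P b θ ψ f) : φ = ψ :=
  LinearMap.ext fun z => algebraMap_injective F P ((hφ z).symm.trans (hψ z))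

end Stability

end BigTorus

end

theorem mainTheorem9
    {R : Type*} [CommRing R] [IsDomain R] [CharZero R]
    (F : FormalGroup R) [F.IsComm]
    {ι X Y : Type*} [Finite ι] [AddCommGroup X] [AddCommGroup Y]
    (P : RootDatum ι X Y) [P.IsReduced]
    (hsimple : BigTorus.IsSimpleDatum P) (hsc : BigTorus.IsSimplyConnectedDatum P)
    (b : P.Base) (θ : ι) (hθ : BigTorus.IsHighestRoot P b θ)
    (hcop : ¬ IsUnit (2 : R) → ∀ a c : ι × ℤ,
      (∃ l : X × ℤ, BigTorus.affRoot P a = 2 • l) →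
      (∃ l : X × ℤ, BigTorus.affRoot P c = 2 • l) →
      BigTorus.affRoot P a ≠ BigTorus.affRoot P c →
      BigTorus.affRoot P a ≠ -BigTorus.affRoot P c →
      BigTorus.CoprimeRoots F P a c) :
    (∀ φ : BigTorus.fada F P b θ →ₗ[BigTorus.SHat F P] BigTorus.SHat F P,
      ∃! f : BigTorus.QWDual F P, BigTorus.Extends F P b θ φ f) ∧
    (∀ (φ ψ : BigTorus.fada F P b θ →ₗ[BigTorus.SHat F P] BigTorus.SHat F P)
      (f : BigTorus.QWDual F P),
      BigTorus.Extends F P b θ φ f → BigTorus.Extends F P b θ ψ f → φ = ψ) ∧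
    BigTorus.fadaDual F P b θ = BigTorus.gkmSet F P := by
  obtain ⟨_, _⟩ := BigTorus.free_finite_of_simplyConnected P hsc
  exact ⟨BigTorus.existsUnique_extends F hsimple hθ,
    fun φ ψ f => BigTorus.eq_of_extends F P,
    (BigTorus.fadaDual_subset_gkmSet F hsimple hθ).antisymm
      (BigTorus.gkmSet_subset_fadaDual F P fun _ _ => BigTorus.coprimeRoots F P hcop)⟩
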